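/- Let $\mathcal{S}_{\mathrm{per}}$ be the space of smooth functions $f:\mathbb{R}^2\to\mathbb{C}$, $(t,x)\mapsto f(t,x)$, that are $2\pi$-periodic in $x$ and Schwartz in $t$, i.e. all partial derivatives of $f$ decay faster than any power of $|t|$, uniformly in $x$. Write $\langle y\rangle=(1+|y|^2)^{1/2}$ and, for $\tau\in\mathbb{R}$, $\xi\in\mathbb{Z}$, $$\mathcal{F}f(\tau,\xi)=\frac{1}{2\pi}\int_{\mathbb{R}}e^{-it\tau}\int_0^{2\pi}e^{-ix\xi}f(t,x)\,dx\,dt .$$ For $s,b\in\mathbb{R}$ put $$\|f\|_{X_{s,b}}^2=\sum_{\xi\in\mathbb{Z}}\int_{\mathbb{R}}\langle\xi\rangle^{2s}\langle\tau+\xi^2\rangle^{2b}|\mathcal{F}f(\tau,\xi)|^2\,d\tau,\qquad \|f\|_{X^-_{s,b}}^2=\sum_{\xi\in\mathbb{Z}}\int_{\mathbb{R}}\langle\xi\rangle^{2s}\langle\tau-\xi^2\rangle^{2b}|\mathcal{F}f(\tau,\xi)|^2\,d\tau,$$ $$\|f\|_{Y_{s,b}}^2=\sum_{\xi\in\mathbb{Z}}\Big(\int_{\mathbb{R}}\langle\tau+\xi^2\rangle^{b}\langle\xi\rangle^{s}|\mathcal{F}f(\tau,\xi)|\,d\tau\Big)^2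 .$$ Theorem. There exist $c,\varepsilon>0$ such that for all $T\in(0,1]$ and all $u_1,u_2,u_3\in\mathcal{S}_{\mathrm{per}}$ with $\operatorname{supp}(u_j)\subset\{(t,x)\mid |t|\le T\}$, $j=1,2,3$, $$\|u_1u_2\,\partial_xu_3\|_{Y_{\frac12,-1}}\le c\,T^{\varepsilon}\,\|u_1\|_{X_{\frac12,\frac12}}\|u_2\|_{X_{\frac12,\frac12}}\|u_3\|_{X^-_{\frac12,\frac12}} .$$ -/

import Mathlib

noncomputable section

namespace PeriodicBourgain

/-- Functions `f (t, x)` on `ℝ × ℝ` that are smooth, `2π`-periodic in `x` and Schwartz in `t`: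
every derivative decays faster than any power of `|t|`, uniformly in `x`. Equivalently,
`x ↦ f (·, x)` is a smooth `2π`-periodic map into the Schwartz space `𝓢(ℝ)`. -/
structure IsSper (f : ℝ × ℝ → ℂ) : Prop where
  smooth : ContDiff ℝ (⊤ : ℕ∞) f
  periodic : ∀ t x : ℝ, f (t, x + 2 * Real.pi) = f (t, x)
  decay : ∀ k n : ℕ, ∃ C : ℝ, ∀ t x : ℝ, |t| ^ k * ‖iteratedFDeriv ℝ n f (t, x)‖ ≤ C

/-- The bracket `⟨y⟩ = (1 + |y|²)^{1/2}`. -/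
def bracket (y : ℝ) : ℝ := Real.sqrt (1 + y ^ 2)

/-- The spatial Fourier coefficient `(2π)^{-1/2} ∫_0^{2π} e^{-ixξ} g(x) dx`. -/
def fourierX (g : ℝ → ℂ) (ξ : ℤ) : ℂ :=
  (((2 * Real.pi) ^ (-(1 / 2) : ℝ) : ℝ) : ℂ) *
    ∫ x in (0 : ℝ)..(2 * Real.pi), Complex.exp (-(Complex.I * x * ξ)) * g x

/-- The temporal Fourier transform `(2π)^{-1/2} ∫ e^{-itτ} g(t) dt`. -/
def fourierT (g : ℝ → ℂ) (τ : ℝ) : ℂ :=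
  (((2 * Real.pi) ^ (-(1 / 2) : ℝ) : ℝ) : ℂ) *
    ∫ t : ℝ, Complex.exp (-(Complex.I * t * τ)) * g t

/-- The space-time Fourier transform `ℱ = ℱ_t ℱ_x`. -/
def fourierTX (f : ℝ × ℝ → ℂ) (τ : ℝ) (ξ : ℤ) : ℂ :=
  fourierT (fun t => fourierX (fun x => f (t, x)) ξ) τ

/-- The norm of `X_{s,b}`, with values in `[0, ∞]`. -/
def normX (s b : ℝ) (f : ℝ × ℝ → ℂ) : ENNReal :=
  (∑' ξ : ℤ, ∫⁻ τ : ℝ, ENNReal.ofReal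
    (bracket ξ ^ (2 * s) * bracket (τ + (ξ : ℝ) ^ 2) ^ (2 * b) * ‖fourierTX f τ ξ‖ ^ 2))
    ^ (1 / 2 : ℝ)

/-- The norm of `X^-_{s,b}`, with values in `[0, ∞]`. -/
def normXminus (s b : ℝ) (f : ℝ × ℝ → ℂ) : ENNReal :=
  (∑' ξ : ℤ, ∫⁻ τ : ℝ, ENNReal.ofReal
    (bracket ξ ^ (2 * s) * bracket (τ - (ξ : ℝ) ^ 2) ^ (2 * b) * ‖fourierTX f τ ξ‖ ^ 2))
    ^ (1 / 2 : ℝ)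

/-- The norm of `Y_{s,b}`, with values in `[0, ∞]`. -/
def normY (s b : ℝ) (f : ℝ × ℝ → ℂ) : ENNReal :=
  (∑' ξ : ℤ, (∫⁻ τ : ℝ, ENNReal.ofReal
    (bracket (τ + (ξ : ℝ) ^ 2) ^ b * bracket ξ ^ s * ‖fourierTX f τ ξ‖)) ^ 2)
    ^ (1 / 2 : ℝ)

/-- The partial derivative `∂_x f`. -/
def partialX (f : ℝ × ℝ → ℂ) : ℝ × ℝ → ℂ :=
  fun p => deriv (fun x => f (p.1, x)) p.2

end PeriodicBourgain

end

/-!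
On the Fourier side the left-hand side is a trilinear convolution with the multiplier
`⟨τ + ξ²⟩⁻¹ ⟨ξ⟩^{1/2} |ξ₃|`. At frequencies `(τ, ξ) = (τ₁, ξ₁) + (τ₂, ξ₂) + (τ₃, ξ₃)` the
modulations satisfy
`(τ + ξ²) - (τ₁ + ξ₁²) - (τ₂ + ξ₂²) - (τ₃ - ξ₃²) = 2 (ξ - ξ₁) (ξ - ξ₂)`,
and `⟨ξ⟩⟨ξ₃⟩` is bounded by a multiple of `⟨ξ₁⟩⟨ξ₂⟩ + |(ξ - ξ₁) (ξ - ξ₂)|`. So either the weights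
of the first two inputs already absorb `⟨ξ⟩^{1/2} ⟨ξ₃⟩^{1/2}`, or the largest of the four
modulations does. In each of these ranges what is left of the multiplier is a kernel to which
Cauchy–Schwarz applies, because for a nonzero integer `k` the equation `(ξ - ξ₁) (ξ - ξ₂) = k` has
few solutions and a quadratic polynomial takes few small values at integers.

Only the input of dominant modulation needs the full weight `⟨·⟩^{1/2}`; for the two others
`⟨·⟩^{31/64}` suffices. By the uncertainty principle, at least half of the `L²`-mass of the Fourier
transform of a function living on `[-T, T]` sits at distance more than `1 / (2T)` from any given
point, so each lowered weight gains a power of `T`.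
-/

open MeasureTheory
open scoped ENNReal NNReal

namespace PeriodicBourgain

/-! ### Decaying weights -/

theorem one_le_bracket (y : ℝ) : 1 ≤ bracket y :=
  Real.one_le_sqrt.mpr (by nlinarith [sq_nonneg y])

theorem bracket_pos (y : ℝ) : 0 < bracket y := one_pos.trans_le (one_le_bracket y)

theorem bracket_sq (y : ℝ) : bracket y ^ 2 = 1 + y ^ 2 := Real.sq_sqrt (by positivity)

theorem bracket_neg (y : ℝ) : bracket (-y) = bracket y := by simp [bracket]

theorem bracket_le_bracket {x y : ℝ} (h : |x| ≤ |y|) : bracket x ≤ bracket y :=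
  Real.sqrt_le_sqrt (by linarith [sq_le_sq.mpr h])

theorem abs_le_bracket (y : ℝ) : |y| ≤ bracket y := Real.abs_le_sqrt (by linarith)

theorem bracket_le_one_add_abs (y : ℝ) : bracket y ≤ 1 + |y| :=
  Real.sqrt_le_iff.mpr ⟨by positivity, by nlinarith [abs_nonneg y, sq_abs y]⟩

theorem bracket_add_le (x y : ℝ) : bracket (x + y) ≤ bracket x + bracket y := by
  have hxy : x * y ≤ bracket x * bracket y :=
    calc x * y ≤ |x| * |y| := by rw [← abs_mul]; exact le_abs_self _
      _ ≤ bracket x * bracket y :=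
        mul_le_mul (abs_le_bracket x) (abs_le_bracket y) (abs_nonneg _) (bracket_pos x).le
  refine le_of_sq_le_sq ?_ (add_pos (bracket_pos x) (bracket_pos y)).le
  linear_combination bracket_sq (x + y) - bracket_sq x - bracket_sq y + 2 * hxy + zero_le_one' ℝ

theorem bracket_le_mul_bracket_mul {a : ℝ} (ha : a ≠ 0) (y : ℝ) :
    bracket y ≤ (1 + |a|⁻¹) * bracket (a * y) := by
  have hy : |y| = |a|⁻¹ * |a * y| := by
    rw [abs_mul, inv_mul_cancel_left₀ (abs_ne_zero.mpr ha)]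
  calc bracket y ≤ 1 + |a|⁻¹ * |a * y| := by
        rw [← hy]
        exact bracket_le_one_add_abs y
    _ ≤ bracket (a * y) + |a|⁻¹ * bracket (a * y) := by
        gcongr
        · exact one_le_bracket _
        · exact abs_le_bracket _
    _ = _ := by ring

theorem continuous_bracket : Continuous bracket := by
  unfold bracket
  fun_prop

/-- The weight `⟨y⟩^{-p}`. Its values are taken in `[0, ∞]`, where sums and integrals need no
convergence hypotheses. -/
noncomputable def decay (p y : ℝ) : ℝ≥0∞ := ENNReal.ofReal (bracket y ^ (-p))

@[fun_prop]
theorem measurable_decay (p : ℝ) : Measurable (decay p) :=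
  ENNReal.measurable_ofReal.comp (continuous_bracket.measurable.pow_const _)

theorem decay_neg (p y : ℝ) : decay p (-y) = decay p y := by simp [decay, bracket_neg]

theorem decay_sub_comm (p x y : ℝ) : decay p (x - y) = decay p (y - x) := by
  rw [← decay_neg, neg_sub]

theorem decay_mul_decay (p q y : ℝ) : decay p y * decay q y = decay (p + q) y := by
  unfold decay
  rw [← ENNReal.ofReal_mul (Real.rpow_nonneg (bracket_pos y).le _), ← Real.rpow_add (bracket_pos y),
    neg_add]

theorem decay_sq (p y : ℝ) : decay p y ^ 2 = decay (2 * p) y := by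
  rw [sq, decay_mul_decay, two_mul]

theorem decay_le_one {p : ℝ} (hp : 0 ≤ p) (y : ℝ) : decay p y ≤ 1 :=
  ENNReal.ofReal_le_one.mpr
    (Real.rpow_le_one_of_one_le_of_nonpos (one_le_bracket y) (neg_nonpos.mpr hp))

theorem decay_le_decay_exponent {p q : ℝ} (h : p ≤ q) (y : ℝ) : decay q y ≤ decay p y :=
  ENNReal.ofReal_le_ofReal
    (Real.rpow_le_rpow_of_exponent_le (one_le_bracket y) (neg_le_neg h))

theorem decay_le_of_bracket_le {p : ℝ} (hp : 0 ≤ p) {x y : ℝ} (h : bracket x ≤ bracket y) :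
    decay p y ≤ decay p x :=
  ENNReal.ofReal_le_ofReal (Real.rpow_le_rpow_of_nonpos (bracket_pos x) h (neg_nonpos.mpr hp))

theorem decay_le_of_abs_le {p : ℝ} (hp : 0 ≤ p) {x y : ℝ} (h : |x| ≤ |y|) :
    decay p y ≤ decay p x :=
  decay_le_of_bracket_le hp (bracket_le_bracket h)

theorem decay_le_mul_of_bracket_pow_le {p : ℝ} (hp : 0 ≤ p) {c : ℝ} (hc : 0 < c) (k : ℕ) {x y : ℝ}
    (h : bracket x ^ k ≤ c * bracket y) :
    decay p y ≤ ENNReal.ofReal (c ^ p) * decay (k * p) x := by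
  have hx := bracket_pos x
  unfold decay
  rw [← ENNReal.ofReal_mul (by positivity)]
  refine ENNReal.ofReal_le_ofReal ?_
  calc bracket y ^ (-p) = c ^ p * (c * bracket y) ^ (-p) := by
        rw [Real.mul_rpow hc.le (bracket_pos y).le, ← mul_assoc, ← Real.rpow_add hc,
          add_neg_cancel, Real.rpow_zero, one_mul]
    _ ≤ c ^ p * (bracket x ^ k) ^ (-p) := by
        gcongr ?_ * ?_
        exact Real.rpow_le_rpow_of_nonpos (by positivity) h (neg_nonpos.mpr hp)
    _ = c ^ p * bracket x ^ (-(k * p)) := by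
        rw [← Real.rpow_natCast, ← Real.rpow_mul hx.le, mul_neg]

theorem decay_le_mul_of_bracket_le {p : ℝ} (hp : 0 ≤ p) {c : ℝ} (hc : 0 < c) {x y : ℝ}
    (h : bracket x ≤ c * bracket y) : decay p y ≤ ENNReal.ofReal (c ^ p) * decay p x := by
  simpa using decay_le_mul_of_bracket_pow_le hp hc 1 (by simpa using h)

theorem decay_mul_decay_le_add {p q : ℝ} (hp : 0 ≤ p) (hq : 0 ≤ q) (x y : ℝ) :
    decay p x * decay q y ≤ decay (p + q) x + decay (p + q) y := by
  rcases le_total (bracket x) (bracket y) with h | h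
  · refine le_trans ?_ le_self_add
    rw [← decay_mul_decay]
    gcongr
    exact decay_le_of_bracket_le hq h
  · refine le_trans ?_ le_add_self
    rw [← decay_mul_decay]
    gcongr
    exact decay_le_of_bracket_le hp h

/-- Moving the exponent `t` from the smaller bracket to the larger one. -/
theorem decay_mul_decay_le_of_transfer {p t : ℝ} (ht : 0 ≤ t) (x y : ℝ) :
    decay p x * decay p y ≤
      decay (p + t) x * decay (p - t) y + decay (p + t) y * decay (p - t) x := by
  wlog h : bracket x ≤ bracket y generalizing x y
  · rw [mul_comm, add_comm]
    exact this y x (le_of_not_ge h)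
  calc decay p x * decay p y = decay p x * (decay t y * decay (p - t) y) := by
        rw [decay_mul_decay, add_sub_cancel]
    _ ≤ decay p x * (decay t x * decay (p - t) y) := by
        gcongr
        exact decay_le_of_bracket_le ht h
    _ = decay (p + t) x * decay (p - t) y := by rw [← mul_assoc, decay_mul_decay]
    _ ≤ _ := le_self_add

theorem decay_mul_decay_le_decay_sub {α β γ : ℝ} (hγ : 0 ≤ γ) (hα : γ ≤ α) (hβ : γ ≤ β)
    (u v : ℝ) :
    decay α u * decay β v ≤ ENNReal.ofReal (2 ^ γ) * decay γ (u - v) *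
      (decay (α + β - γ) u + decay (α + β - γ) v) := by
  wlog huv : bracket v ≤ bracket u generalizing u v α β
  · have := this hβ hα v u (le_of_not_ge huv)
    rwa [mul_comm (decay α u), decay_sub_comm γ u v, add_comm (decay (α + β - γ) u), add_comm α β]
  have hbracket : bracket (u - v) ≤ 2 * bracket u := by
    have := bracket_add_le u (-v)
    rw [bracket_neg, ← sub_eq_add_neg] at this
    linarith
  calc decay α u * decay β v = decay γ u * (decay (α - γ) u * decay β v) := by
        rw [← mul_assoc, decay_mul_decay, add_sub_cancel]
    _ ≤ ENNReal.ofReal (2 ^ γ) * decay γ (u - v) * (decay (α - γ + β) u + decay (α - γ + β) v) := by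
        gcongr
        · exact decay_le_mul_of_bracket_le hγ two_pos hbracket
        · exact decay_mul_decay_le_add (by linarith) (by linarith) u v
    _ = _ := by rw [sub_add_eq_add_sub]

theorem decay_mul_le_add_decay_two_mul {p : ℝ} (hp : 0 ≤ p) (z w : ℝ) :
    decay p (z * w) ≤ ENNReal.ofReal (4 ^ p) * (decay (2 * p) z + decay (2 * p) w) := by
  wlog h : |z| ≤ |w| generalizing z w
  · rw [mul_comm, add_comm]
    exact this w z (le_of_not_ge h)
  have hzw : z ^ 2 ≤ |z * w| := by
    rw [abs_mul, ← sq_abs, sq]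
    gcongr
  have hbracket : bracket z ^ 2 ≤ 4 * bracket (z * w) := by
    rw [bracket_sq]
    linarith [abs_le_bracket (z * w), one_le_bracket (z * w)]
  calc decay p (z * w) ≤ ENNReal.ofReal (4 ^ p) * decay (2 * p) z := by
        simpa using decay_le_mul_of_bracket_pow_le hp four_pos 2 hbracket
    _ ≤ _ := by gcongr; exact le_self_add

/-! ### Convolution integrals of decaying weights -/

theorem exists_lintegral_decay_le {p : ℝ} (hp : 1 < p) :
    ∃ C : ℝ≥0, ∀ y : ℝ, ∫⁻ x, decay p (x - y) ≤ C := by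
  have hint : Integrable fun x : ℝ => bracket x ^ (-p) := by
    have h :=
      integrable_rpow_neg_one_add_norm_sq (E := ℝ) (μ := volume) (r := p) (by simpa using hp)
    refine h.congr (Filter.Eventually.of_forall fun x => ?_)
    simp only [bracket, Real.norm_eq_abs, sq_abs]
    rw [Real.sqrt_eq_rpow, ← Real.rpow_mul (by positivity)]
    congr 1
    ring
  have htop : ∫⁻ x, decay p x ≠ ∞ := hint.lintegral_lt_top.ne
  refine ⟨(∫⁻ x, decay p x).toNNReal, fun y => ?_⟩
  rw [ENNReal.coe_toNNReal htop]
  exact (lintegral_sub_right_eq_self (decay p) y).le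

theorem exists_lintegral_decay_mul_decay_le {α β γ : ℝ} (hγ : 0 ≤ γ) (hα : γ ≤ α) (hβ : γ ≤ β)
    (h : 1 < α + β - γ) :
    ∃ C : ℝ≥0, ∀ a b : ℝ, ∫⁻ x, decay α (x - a) * decay β (x - b) ≤ C * decay γ (a - b) := by
  obtain ⟨C, hC⟩ := exists_lintegral_decay_le h
  refine ⟨((2 : ℝ) ^ γ).toNNReal * (C + C), fun a b => ?_⟩
  calc ∫⁻ x, decay α (x - a) * decay β (x - b)
      ≤ ∫⁻ x, ENNReal.ofReal (2 ^ γ) * decay γ (a - b) *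
          (decay (α + β - γ) (x - a) + decay (α + β - γ) (x - b)) := by
        refine lintegral_mono fun x => (decay_mul_decay_le_decay_sub hγ hα hβ _ _).trans_eq ?_
        rw [sub_sub_sub_cancel_left, decay_sub_comm]
    _ = ENNReal.ofReal (2 ^ γ) * decay γ (a - b) *
          ((∫⁻ x, decay (α + β - γ) (x - a)) + ∫⁻ x, decay (α + β - γ) (x - b)) := by
        rw [lintegral_const_mul _ (by fun_prop), lintegral_add_left (by fun_prop)]
    _ ≤ ENNReal.ofReal (2 ^ γ) * decay γ (a - b) * (C + C) := by gcongr <;> exact hC _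
    _ = _ := by
        push_cast
        rw [ENNReal.ofReal]
        ring

theorem exists_lintegral_lintegral_decay_le {α δ : ℝ} (hδ : 0 ≤ δ) (hδα : δ ≤ α)
    (h : δ + 2 < 3 * α) :
    ∃ C : ℝ≥0, ∀ a b c : ℝ, ∫⁻ x, ∫⁻ y, decay α (x - a) * decay α (y - b) * decay α (x + y - c) ≤
      C * decay δ (a + b - c) := by
  obtain ⟨C, hC⟩ := exists_lintegral_decay_mul_decay_le (α := α) (β := α) (γ := (α + δ) / 2)
    (by linarith) (by linarith) (by linarith) (by linarith)
  obtain ⟨D, hD⟩ := exists_lintegral_decay_mul_decay_le (α := α) (β := (α + δ) / 2) (γ := δ)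
    hδ hδα (by linarith) (by linarith)
  refine ⟨C * D, fun a b c => ?_⟩
  calc ∫⁻ x, ∫⁻ y, decay α (x - a) * decay α (y - b) * decay α (x + y - c)
      = ∫⁻ x, decay α (x - a) * ∫⁻ y, decay α (y - b) * decay α (y - (c - x)) := by
        refine lintegral_congr fun x => ?_
        rw [← lintegral_const_mul _ (by fun_prop)]
        refine lintegral_congr fun y => ?_
        rw [mul_assoc, show x + y - c = y - (c - x) by ring]
    _ ≤ ∫⁻ x, decay α (x - a) * (C * decay ((α + δ) / 2) (x - (c - b))) := by
        gcongr with x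
        refine (hC _ _).trans_eq ?_
        rw [show b - (c - x) = x - (c - b) by ring]
    _ = C * ∫⁻ x, decay α (x - a) * decay ((α + δ) / 2) (x - (c - b)) := by
        rw [← lintegral_const_mul _ (by fun_prop)]
        refine lintegral_congr fun x => ?_
        ring
    _ ≤ C * (D * decay δ (a - (c - b))) := by gcongr; exact hD _ _
    _ = _ := by
        rw [show a - (c - b) = a + b - c by ring, ENNReal.coe_mul, mul_assoc]

/-! ### Sums of decaying weights over the integers -/

theorem summable_bracket_rpow {p : ℝ} (hp : 1 < p) :
    Summable fun n : ℤ => bracket n ^ (-p) := by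
  refine (Real.summable_abs_int_rpow hp).of_norm_bounded_eventually ?_
  filter_upwards [(Set.finite_singleton (0 : ℤ)).compl_mem_cofinite] with n hn
  have hn' : (0 : ℝ) < |(n : ℝ)| := abs_pos.mpr (Int.cast_ne_zero.mpr hn)
  rw [Real.norm_of_nonneg (Real.rpow_nonneg (bracket_pos _).le _)]
  exact Real.rpow_le_rpow_of_nonpos hn' (abs_le_bracket _) (by linarith)

theorem exists_tsum_decay_le {p : ℝ} (hp : 1 < p) :
    ∃ C : ℝ≥0, ∀ y : ℝ, ∑' n : ℤ, decay p (n - y) ≤ C := by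
  have htop : ∑' n : ℤ, decay p n ≠ ∞ := (summable_bracket_rpow hp).tsum_ofReal_ne_top
  refine ⟨(ENNReal.ofReal (3 ^ p) * ∑' n : ℤ, decay p n).toNNReal, fun y => ?_⟩
  rw [ENNReal.coe_toNNReal (ENNReal.mul_ne_top ENNReal.ofReal_ne_top htop),
    ← (Equiv.addRight ⌊y⌋).tsum_eq, ← ENNReal.tsum_mul_left]
  refine ENNReal.tsum_le_tsum fun n => decay_le_mul_of_bracket_le (by linarith) three_pos ?_
  have hshift : ((Equiv.addRight ⌊y⌋ n : ℤ) : ℝ) - y = n - Int.fract y := by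
    rw [Equiv.coe_addRight, Int.cast_add, Int.fract]
    ring
  have hfract : bracket (Int.fract y) ≤ 2 := by
    have := bracket_le_one_add_abs (Int.fract y)
    rw [abs_of_nonneg (Int.fract_nonneg y)] at this
    linarith [Int.fract_lt_one y]
  rw [hshift]
  calc bracket n = bracket ((n - Int.fract y) + Int.fract y) := by rw [sub_add_cancel]
    _ ≤ bracket (n - Int.fract y) + bracket (Int.fract y) := bracket_add_le _ _
    _ ≤ 3 * bracket (n - Int.fract y) := by linarith [one_le_bracket (n - Int.fract y)]

theorem exists_tsum_decay_linear_le {p : ℝ} (hp : 1 < p) :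
    ∃ C : ℝ≥0, ∀ c d : ℝ, 1 ≤ |c| → ∑' n : ℤ, decay p (c * n + d) ≤ C := by
  obtain ⟨C, hC⟩ := exists_tsum_decay_le hp
  refine ⟨C, fun c d hc => (ENNReal.tsum_le_tsum fun n => ?_).trans (hC (-(d / c)))⟩
  have hc0 : c ≠ 0 := abs_pos.mp (one_pos.trans_le hc)
  refine decay_le_of_abs_le (by linarith) ?_
  rw [show c * n + d = c * (n - -(d / c)) by field_simp; ring, abs_mul]
  exact le_mul_of_one_le_left (abs_nonneg _) hc

theorem exists_abs_mul_sub_le_abs_quadratic (b c : ℝ) :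
    ∃ r₁ r₂ : ℝ, ∀ x : ℝ, |(x - r₁) * (x - r₂)| ≤ |x ^ 2 + b * x + c| := by
  set d := b ^ 2 / 4 - c with hd
  rcases le_total 0 d with h | h
  · refine ⟨-(b / 2) + √d, -(b / 2) - √d, fun x => le_of_eq (congrArg _ ?_)⟩
    linear_combination -Real.sq_sqrt h - hd
  · refine ⟨-(b / 2), -(b / 2), fun x => abs_le_abs_of_nonneg ?_ ?_⟩
    · nlinarith [sq_nonneg (x + b / 2)]
    · linear_combination h + hd

theorem exists_tsum_decay_quadratic_le {p : ℝ} (hp : 1 / 2 < p) {a : ℝ} (ha : a ≠ 0) :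
    ∃ C : ℝ≥0, ∀ b c : ℝ, ∑' n : ℤ, decay p (a * (n : ℝ) ^ 2 + b * n + c) ≤ C := by
  have hp0 : 0 ≤ p := by linarith
  obtain ⟨C, hC⟩ := exists_tsum_decay_le (p := 2 * p) (by linarith)
  refine ⟨((1 + |a|⁻¹) ^ p).toNNReal * (((4 : ℝ) ^ p).toNNReal * (C + C)), fun b c => ?_⟩
  obtain ⟨r₁, r₂, hr⟩ := exists_abs_mul_sub_le_abs_quadratic (b / a) (c / a)
  calc ∑' n : ℤ, decay p (a * (n : ℝ) ^ 2 + b * n + c)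
      ≤ ∑' n : ℤ, ENNReal.ofReal ((1 + |a|⁻¹) ^ p) *
          (ENNReal.ofReal (4 ^ p) * (decay (2 * p) (n - r₁) + decay (2 * p) (n - r₂))) := by
        refine ENNReal.tsum_le_tsum fun n => ?_
        rw [show a * (n : ℝ) ^ 2 + b * n + c = a * (n ^ 2 + b / a * n + c / a) by field_simp]
        refine (decay_le_mul_of_bracket_le hp0 (by positivity)
          (bracket_le_mul_bracket_mul ha _)).trans ?_
        gcongr
        exact (decay_le_of_abs_le hp0 (hr n)).trans (decay_mul_le_add_decay_two_mul hp0 _ _)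
    _ = ENNReal.ofReal ((1 + |a|⁻¹) ^ p) * (ENNReal.ofReal (4 ^ p) *
          (∑' n : ℤ, decay (2 * p) (n - r₁) + ∑' n : ℤ, decay (2 * p) (n - r₂))) := by
        rw [ENNReal.tsum_mul_left, ENNReal.tsum_mul_left, ENNReal.tsum_add]
    _ ≤ ENNReal.ofReal ((1 + |a|⁻¹) ^ p) * (ENNReal.ofReal (4 ^ p) * (C + C)) := by
        gcongr <;> exact hC _
    _ = _ := by push_cast; rfl

/-! ### Trilinear convolutions -/

theorem lintegral_mul_sq_le {X : Type*} [MeasurableSpace X] {μ : Measure X} {f g : X → ℝ≥0∞}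
    (hf : Measurable f) (hg : Measurable g) :
    (∫⁻ x, f x * g x ∂μ) ^ 2 ≤ (∫⁻ x, f x ^ 2 ∂μ) * ∫⁻ x, g x ^ 2 ∂μ := by
  have hsqrt (a : ℝ≥0∞) : (a ^ (1 / 2 : ℝ)) ^ 2 = a := by
    rw [← ENNReal.rpow_natCast, ← ENNReal.rpow_mul]
    norm_num
  have h := ENNReal.lintegral_mul_le_Lp_mul_Lq μ Real.HolderConjugate.two_two
    hf.aemeasurable hg.aemeasurable
  simp only [ENNReal.rpow_two] at h
  calc (∫⁻ x, f x * g x ∂μ) ^ 2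
      ≤ ((∫⁻ x, f x ^ 2 ∂μ) ^ (1 / 2 : ℝ) * (∫⁻ x, g x ^ 2 ∂μ) ^ (1 / 2 : ℝ)) ^ 2 := by
        gcongr
        exact h
    _ = _ := by rw [mul_pow, hsqrt, hsqrt]

theorem add_sq_le_two_mul (a b : ℝ≥0∞) : (a + b) ^ 2 ≤ 2 * (a ^ 2 + b ^ 2) := by
  have h := ENNReal.rpow_add_le_mul_rpow_add_rpow a b one_le_two
  norm_num at h
  exact h

theorem lintegral_lintegral_mul_sq_le {X Y : Type*} [MeasurableSpace X] [MeasurableSpace Y]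
    {μ : Measure X} {ν : Measure Y} [SFinite ν] {f g : X × Y → ℝ≥0∞} {A : ℝ≥0∞}
    (hf : Measurable f) (hg : Measurable g) (hA : ∀ x, ∫⁻ y, f (x, y) ^ 2 ∂ν ≤ A) :
    ∫⁻ x, (∫⁻ y, f (x, y) * g (x, y) ∂ν) ^ 2 ∂μ ≤ A * ∫⁻ x, ∫⁻ y, g (x, y) ^ 2 ∂ν ∂μ := by
  rw [← lintegral_const_mul _ (hg.pow_const 2).lintegral_prod_right']
  refine lintegral_mono fun x => (lintegral_mul_sq_le ?_ ?_).trans (mul_le_mul_left (hA x) _)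
  · exact hf.comp measurable_prodMk_left
  · exact hg.comp measurable_prodMk_left

theorem lintegral_prod_mul_sq {X Y : Type*} [MeasurableSpace X] [MeasurableSpace Y]
    {μ : Measure X} {ν : Measure Y} [SFinite ν] {f : X → ℝ≥0∞} {g : Y → ℝ≥0∞}
    (hf : Measurable f) (hg : Measurable g) :
    ∫⁻ z, (f z.1 * g z.2) ^ 2 ∂(μ.prod ν) = (∫⁻ x, f x ^ 2 ∂μ) * ∫⁻ y, g y ^ 2 ∂ν := by
  simp only [mul_pow]
  exact lintegral_prod_mul (hf.pow_const 2).aemeasurable (hg.pow_const 2).aemeasurable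

theorem lintegral_lintegral_mul_fst_sq_le {X Y : Type*} [MeasurableSpace X] [MeasurableSpace Y]
    {μ : Measure X} {ν : Measure Y} {F : X × Y → ℝ≥0∞} {f : X → ℝ≥0∞} {C : ℝ≥0∞}
    (hF : Measurable F) (hf : Measurable f) (hC : ∀ x, ∫⁻ y, F (x, y) ^ 2 ∂ν ≤ C) :
    ∫⁻ x, ∫⁻ y, (F (x, y) * f x) ^ 2 ∂ν ∂μ ≤ C * ∫⁻ x, f x ^ 2 ∂μ := by
  rw [← lintegral_const_mul _ (hf.pow_const 2)]
  refine lintegral_mono fun x => ?_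
  have hFx : Measurable fun y => F (x, y) := hF.comp measurable_prodMk_left
  simp only [mul_pow]
  rw [lintegral_mul_const _ (hFx.pow_const 2)]
  exact mul_le_mul_left (hC x) _

theorem lintegral_lintegral_prod_rotate {X Y Z : Type*} [MeasurableSpace X] [MeasurableSpace Y]
    [MeasurableSpace Z] {μ : Measure X} {ν : Measure Y} {ρ : Measure Z} [SFinite μ] [SFinite ν]
    [SFinite ρ] {H : X × Y × Z → ℝ≥0∞} (hH : Measurable H) :
    ∫⁻ x, ∫⁻ q : Y × Z, H (x, q) ∂(ν.prod ρ) ∂μ =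
      ∫⁻ y, ∫⁻ q : Z × X, H (q.2, y, q.1) ∂(ρ.prod μ) ∂ν := by
  have hH' : Measurable fun z : (X × Y) × Z => H (z.1.1, z.1.2, z.2) :=
    hH.comp (f := fun z : (X × Y) × Z => (z.1.1, z.1.2, z.2)) (by fun_prop)
  calc ∫⁻ x, ∫⁻ q : Y × Z, H (x, q) ∂(ν.prod ρ) ∂μ
      = ∫⁻ x, ∫⁻ y, ∫⁻ z, H (x, y, z) ∂ρ ∂ν ∂μ :=
        lintegral_congr fun x =>
          lintegral_prod _ (hH.comp measurable_prodMk_left).aemeasurable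
    _ = ∫⁻ y, ∫⁻ x, ∫⁻ z, H (x, y, z) ∂ρ ∂μ ∂ν :=
        lintegral_lintegral_swap hH'.lintegral_prod_right'.aemeasurable
    _ = _ := by
        refine lintegral_congr fun y =>
          (lintegral_prod_symm (fun q : Z × X => H (q.2, y, q.1)) ?_).symm
        exact (hH.comp (f := fun q : Z × X => (q.2, y, q.1)) (by fun_prop)).aemeasurable

section Trilinear

variable {G : Type*} [AddCommGroup G] [MeasurableSpace G] {μ : Measure G}
  {K : G → G → G → ℝ≥0∞} {f₁ f₂ f₃ : G → ℝ≥0∞}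

/-- The trilinear convolution with kernel `K`, evaluated at `p`. The third variable
`q₃ = p - q₁ - q₂` is eliminated. -/
noncomputable def trilin (μ : Measure G) (K : G → G → G → ℝ≥0∞) (f₁ f₂ f₃ : G → ℝ≥0∞) (p : G) :
    ℝ≥0∞ :=
  ∫⁻ q : G × G, K p q.1 q.2 * (f₁ q.1 * f₂ q.2 * f₃ (p - q.1 - q.2)) ∂(μ.prod μ)

/-- The measurable kernels whose trilinear convolution maps `L² × L² × L²` boundedly to `L²`. -/
structure IsL2Kernel (μ : Measure G) (K : G → G → G → ℝ≥0∞) : Prop where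
  measurable : Measurable fun z : G × G × G => K z.1 z.2.1 z.2.2
  bound : ∃ C : ℝ≥0, ∀ f₁ f₂ f₃ : G → ℝ≥0∞, Measurable f₁ → Measurable f₂ → Measurable f₃ →
    ∫⁻ p, trilin μ K f₁ f₂ f₃ p ^ 2 ∂μ ≤
      C * ((∫⁻ q, f₁ q ^ 2 ∂μ) * (∫⁻ q, f₂ q ^ 2 ∂μ) * ∫⁻ q, f₃ q ^ 2 ∂μ)

theorem measurable_trilin_integrand [MeasurableAdd₂ G] [MeasurableNeg G]
    (hK : Measurable fun z : G × G × G => K z.1 z.2.1 z.2.2) (h₁ : Measurable f₁)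
    (h₂ : Measurable f₂) (h₃ : Measurable f₃) : Measurable fun z : G × G × G =>
      K z.1 z.2.1 z.2.2 * (f₁ z.2.1 * f₂ z.2.2 * f₃ (z.1 - z.2.1 - z.2.2)) :=
  hK.mul (by fun_prop)

theorem trilin_add [MeasurableAdd₂ G] [MeasurableNeg G] {L : G → G → G → ℝ≥0∞}
    (hK : Measurable fun z : G × G × G => K z.1 z.2.1 z.2.2)
    (h₁ : Measurable f₁) (h₂ : Measurable f₂) (h₃ : Measurable f₃) (p : G) :
    trilin μ (fun p q₁ q₂ => K p q₁ q₂ + L p q₁ q₂) f₁ f₂ f₃ p =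
      trilin μ K f₁ f₂ f₃ p + trilin μ L f₁ f₂ f₃ p := by
  simp only [trilin, add_mul]
  exact lintegral_add_left
    ((measurable_trilin_integrand hK h₁ h₂ h₃).comp measurable_prodMk_left) _

theorem trilin_le_mul_trilin {L : G → G → G → ℝ≥0∞} {c : ℝ≥0}
    (h : ∀ p q₁ q₂, K p q₁ q₂ ≤ c * L p q₁ q₂) (p : G) :
    trilin μ K f₁ f₂ f₃ p ≤ c * trilin μ L f₁ f₂ f₃ p := by
  rw [trilin, trilin, ← lintegral_const_mul' _ _ ENNReal.coe_ne_top]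
  refine lintegral_mono fun q => ?_
  exact (mul_le_mul_left (h _ _ _) _).trans_eq (mul_assoc _ _ _)

variable [SFinite μ]

theorem measurable_trilin [MeasurableAdd₂ G] [MeasurableNeg G]
    (hK : Measurable fun z : G × G × G => K z.1 z.2.1 z.2.2)
    (h₁ : Measurable f₁) (h₂ : Measurable f₂) (h₃ : Measurable f₃) :
    Measurable (trilin μ K f₁ f₂ f₃) :=
  (measurable_trilin_integrand hK h₁ h₂ h₃).lintegral_prod_right'

theorem trilin_swap (p : G) :
    trilin μ (fun p q₁ q₂ => K p q₂ q₁) f₁ f₂ f₃ p = trilin μ K f₂ f₁ f₃ p := by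
  unfold trilin
  rw [← lintegral_prod_swap]
  refine lintegral_congr fun q => ?_
  rw [Prod.fst_swap, Prod.snd_swap, mul_comm (f₁ _), sub_right_comm]

theorem IsL2Kernel.swap (hK : IsL2Kernel μ K) :
    IsL2Kernel μ fun p q₁ q₂ => K p q₂ q₁ where
  measurable := hK.measurable.comp (f := fun z : G × G × G => (z.1, z.2.2, z.2.1)) (by fun_prop)
  bound := by
    obtain ⟨C, hC⟩ := hK.bound
    refine ⟨C, fun f₁ f₂ f₃ h₁ h₂ h₃ => ?_⟩
    simp only [trilin_swap]
    rw [mul_comm (∫⁻ q, f₁ q ^ 2 ∂μ)]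
    exact hC f₂ f₁ f₃ h₂ h₁ h₃

theorem IsL2Kernel.add [MeasurableAdd₂ G] [MeasurableNeg G] {L : G → G → G → ℝ≥0∞}
    (hK : IsL2Kernel μ K) (hL : IsL2Kernel μ L) :
    IsL2Kernel μ fun p q₁ q₂ => K p q₁ q₂ + L p q₁ q₂ where
  measurable := hK.measurable.add hL.measurable
  bound := by
    obtain ⟨C, hC⟩ := hK.bound
    obtain ⟨D, hD⟩ := hL.bound
    refine ⟨2 * (C + D), fun f₁ f₂ f₃ h₁ h₂ h₃ => ?_⟩
    have mK := (measurable_trilin (μ := μ) hK.measurable h₁ h₂ h₃).pow_const 2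
    simp only [trilin_add hK.measurable h₁ h₂ h₃]
    calc ∫⁻ p, (trilin μ K f₁ f₂ f₃ p + trilin μ L f₁ f₂ f₃ p) ^ 2 ∂μ
        ≤ 2 * ((∫⁻ p, trilin μ K f₁ f₂ f₃ p ^ 2 ∂μ) + ∫⁻ p, trilin μ L f₁ f₂ f₃ p ^ 2 ∂μ) := by
          rw [← lintegral_add_left mK, ← lintegral_const_mul' _ _ ENNReal.ofNat_ne_top]
          exact lintegral_mono fun p => add_sq_le_two_mul _ _
      _ ≤ 2 * (C * _ + D * _) := by
          gcongr
          exacts [hC _ _ _ h₁ h₂ h₃, hD _ _ _ h₁ h₂ h₃]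
      _ = _ := by
          push_cast
          ring

variable [MeasurableAdd₂ G] [MeasurableNeg G] [μ.IsAddLeftInvariant]

theorem lintegral_lintegral_prod_sub {H : G × G × G → ℝ≥0∞} (hH : Measurable H) :
    ∫⁻ p, ∫⁻ q : G × G, H (p - q.1 - q.2, q) ∂(μ.prod μ) ∂μ =
      ∫⁻ r, ∫⁻ q, H (r, q) ∂(μ.prod μ) ∂μ := by
  rw [lintegral_lintegral_swap, lintegral_lintegral_swap (f := fun r q => H (r, q)) hH.aemeasurable]
  · refine lintegral_congr fun q => ?_
    simp only [sub_sub]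
    exact lintegral_sub_right_eq_self (fun r => H (r, q)) (q.1 + q.2)
  · exact (hH.comp (f := fun z : G × G × G => (z.1 - z.2.1 - z.2.2, z.2))
      (by fun_prop)).aemeasurable

theorem lintegral_prod_mul_sub [μ.IsNegInvariant] {F : G × G → ℝ≥0∞} {f : G → ℝ≥0∞}
    (hF : Measurable F) (hf : Measurable f) (p : G) :
    ∫⁻ q, F q * f (p - q.1 - q.2) ∂(μ.prod μ) =
      ∫⁻ r, (∫⁻ q, F (q, p - r - q) ∂μ) * f r ∂μ := by
  have hm : Measurable fun q : G × G => F q * f (p - q.1 - q.2) := by fun_prop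
  calc ∫⁻ q, F q * f (p - q.1 - q.2) ∂(μ.prod μ)
      = ∫⁻ q, ∫⁻ r, F (q, p - q - r) * f r ∂μ ∂μ := by
        rw [lintegral_prod _ hm.aemeasurable]
        refine lintegral_congr fun q => ?_
        rw [← lintegral_sub_left_eq_self _ (p - q)]
        simp only [sub_sub_cancel]
    _ = ∫⁻ r, ∫⁻ q, F (q, p - r - q) * f r ∂μ ∂μ := by
        rw [lintegral_lintegral_swap]
        · simp only [sub_right_comm p]
        · have h : Measurable fun z : G × G => F (z.1, p - z.1 - z.2) * f z.2 := by fun_prop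
          exact h.aemeasurable
    _ = _ := by
        refine lintegral_congr fun r => lintegral_mul_const _ ?_
        exact hF.comp (f := fun q => (q, p - r - q)) (by fun_prop)

theorem isL2Kernel_of_output (hK : Measurable fun z : G × G × G => K z.1 z.2.1 z.2.2)
    (C : ℝ≥0) (hC : ∀ p, ∫⁻ q : G × G, K p q.1 q.2 ^ 2 ∂(μ.prod μ) ≤ C) : IsL2Kernel μ K where
  measurable := hK
  bound := by
    refine ⟨C, fun f₁ f₂ f₃ h₁ h₂ h₃ => ?_⟩
    calc ∫⁻ p, trilin μ K f₁ f₂ f₃ p ^ 2 ∂μ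
        ≤ C * ∫⁻ p, ∫⁻ q : G × G, (f₁ q.1 * f₂ q.2 * f₃ (p - q.1 - q.2)) ^ 2 ∂(μ.prod μ) ∂μ :=
          lintegral_lintegral_mul_sq_le
            (g := fun z : G × G × G => f₁ z.2.1 * f₂ z.2.2 * f₃ (z.1 - z.2.1 - z.2.2))
            hK (by fun_prop) hC
      _ = C * ∫⁻ z : G × G × G, (f₃ z.1 * (f₁ z.2.1 * f₂ z.2.2)) ^ 2 ∂(μ.prod (μ.prod μ)) := by
          have h : Measurable fun z : G × G × G => (f₃ z.1 * (f₁ z.2.1 * f₂ z.2.2)) ^ 2 := by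
            fun_prop
          rw [lintegral_prod _ h.aemeasurable, ← lintegral_lintegral_prod_sub h]
          simp only [mul_comm (f₃ _)]
      _ = _ := by
          rw [lintegral_prod_mul_sq (g := fun q : G × G => f₁ q.1 * f₂ q.2) h₃ (by fun_prop),
            lintegral_prod_mul_sq h₁ h₂, mul_comm (∫⁻ q, f₃ q ^ 2 ∂μ)]

theorem isL2Kernel_of_third (hK : Measurable fun z : G × G × G => K z.1 z.2.1 z.2.2) (C : ℝ≥0)
    (hC : ∀ r, ∫⁻ q : G × G, K (r + (q.1 + q.2)) q.1 q.2 ^ 2 ∂(μ.prod μ) ≤ C) :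
    IsL2Kernel μ K where
  measurable := hK
  bound := by
    refine ⟨C, fun f₁ f₂ f₃ h₁ h₂ h₃ => ?_⟩
    have hK' : Measurable fun z : G × G × G => K (z.1 + (z.2.1 + z.2.2)) z.2.1 z.2.2 :=
      hK.comp (f := fun z : G × G × G => (z.1 + (z.2.1 + z.2.2), z.2)) (by fun_prop)
    set N := (∫⁻ q, f₁ q ^ 2 ∂μ) * ∫⁻ q, f₂ q ^ 2 ∂μ
    calc ∫⁻ p, trilin μ K f₁ f₂ f₃ p ^ 2 ∂μ
        = ∫⁻ p, (∫⁻ q : G × G, (f₁ q.1 * f₂ q.2) *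
            (K p q.1 q.2 * f₃ (p - q.1 - q.2)) ∂(μ.prod μ)) ^ 2 ∂μ := by
          simp only [trilin, mul_left_comm (K _ _ _)]
      _ ≤ N * ∫⁻ p, ∫⁻ q : G × G, (K p q.1 q.2 * f₃ (p - q.1 - q.2)) ^ 2 ∂(μ.prod μ) ∂μ :=
          lintegral_lintegral_mul_sq_le (f := fun z : G × G × G => f₁ z.2.1 * f₂ z.2.2)
            (g := fun z : G × G × G => K z.1 z.2.1 z.2.2 * f₃ (z.1 - z.2.1 - z.2.2))
            (by fun_prop) (by fun_prop) fun _ => (lintegral_prod_mul_sq h₁ h₂).le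
      _ = N * ∫⁻ r, ∫⁻ q : G × G, (K (r + (q.1 + q.2)) q.1 q.2 * f₃ r) ^ 2 ∂(μ.prod μ) ∂μ := by
          have h : Measurable fun z : G × G × G =>
              (K (z.1 + (z.2.1 + z.2.2)) z.2.1 z.2.2 * f₃ z.1) ^ 2 :=
            (hK'.mul (h₃.comp measurable_fst)).pow_const 2
          rw [← lintegral_lintegral_prod_sub h]
          simp only [sub_sub, sub_add_cancel]
      _ ≤ N * (C * ∫⁻ r, f₃ r ^ 2 ∂μ) :=
          mul_le_mul_right (lintegral_lintegral_mul_fst_sq_le hK' h₃ hC) _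
      _ = _ := mul_left_comm _ _ _

variable [μ.IsNegInvariant]

theorem isL2Kernel_of_first (hK : Measurable fun z : G × G × G => K z.1 z.2.1 z.2.2) (C : ℝ≥0)
    (hC : ∀ r, ∫⁻ q : G × G, K (q.2 + (r + q.1)) r q.1 ^ 2 ∂(μ.prod μ) ≤ C) :
    IsL2Kernel μ K where
  measurable := hK
  bound := by
    refine ⟨C, fun f₁ f₂ f₃ h₁ h₂ h₃ => ?_⟩
    have hK₁ : Measurable fun z : G × G × G => K (z.1 + (z.2.1 + z.2.2)) z.2.1 z.2.2 :=
      hK.comp (f := fun z : G × G × G => (z.1 + (z.2.1 + z.2.2), z.2)) (by fun_prop)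
    have hK₂ : Measurable fun z : G × G × G => K (z.2.2 + (z.1 + z.2.1)) z.1 z.2.1 :=
      hK.comp (f := fun z : G × G × G => (z.2.2 + (z.1 + z.2.1), z.1, z.2.1)) (by fun_prop)
    set N := (∫⁻ q, f₂ q ^ 2 ∂μ) * ∫⁻ q, f₃ q ^ 2 ∂μ with hN
    have hpair (p : G) : ∫⁻ q : G × G, (f₂ q.2 * f₃ (p - q.1 - q.2)) ^ 2 ∂(μ.prod μ) = N := by
      simp only [mul_pow]
      rw [lintegral_prod_mul_sub (F := fun q => f₂ q.2 ^ 2) (f := fun r => f₃ r ^ 2)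
        (by fun_prop) (by fun_prop), hN, ← lintegral_const_mul _ (h₃.pow_const 2)]
      simp only [lintegral_sub_left_eq_self (fun q => f₂ q ^ 2)]
    calc ∫⁻ p, trilin μ K f₁ f₂ f₃ p ^ 2 ∂μ
        = ∫⁻ p, (∫⁻ q : G × G, (f₂ q.2 * f₃ (p - q.1 - q.2)) *
            (K p q.1 q.2 * f₁ q.1) ∂(μ.prod μ)) ^ 2 ∂μ := by
          refine lintegral_congr fun p => congrArg (· ^ 2) (lintegral_congr fun q => ?_)
          ring
      _ ≤ N * ∫⁻ p, ∫⁻ q : G × G, (K p q.1 q.2 * f₁ q.1) ^ 2 ∂(μ.prod μ) ∂μ :=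
          lintegral_lintegral_mul_sq_le
            (f := fun z : G × G × G => f₂ z.2.2 * f₃ (z.1 - z.2.1 - z.2.2))
            (g := fun z : G × G × G => K z.1 z.2.1 z.2.2 * f₁ z.2.1)
            (by fun_prop) (by fun_prop) fun p => (hpair p).le
      _ = N * ∫⁻ r, ∫⁻ q : G × G, (K (q.2 + (r + q.1)) r q.1 * f₁ r) ^ 2 ∂(μ.prod μ) ∂μ := by
          have h : Measurable fun z : G × G × G =>
              (K (z.1 + (z.2.1 + z.2.2)) z.2.1 z.2.2 * f₁ z.2.1) ^ 2 :=
            (hK₁.mul (h₁.comp (measurable_fst.comp measurable_snd))).pow_const 2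
          rw [← lintegral_lintegral_prod_rotate h, ← lintegral_lintegral_prod_sub h]
          simp only [sub_sub, sub_add_cancel]
      _ ≤ N * (C * ∫⁻ r, f₁ r ^ 2 ∂μ) :=
          mul_le_mul_right (lintegral_lintegral_mul_fst_sq_le hK₂ h₁ hC) _
      _ = _ := by ring

theorem isL2Kernel_of_pairs {A B : G → G → ℝ≥0∞} (hA : Measurable (Function.uncurry A))
    (hB : Measurable (Function.uncurry B)) (C D : ℝ≥0)
    (hC : ∀ r, ∫⁻ p, A p (p - r) ^ 2 ∂μ ≤ C) (hD : ∀ r, ∫⁻ q, B q (r - q) ^ 2 ∂μ ≤ D) :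
    IsL2Kernel μ fun p q₁ q₂ => A p (p - q₁ - q₂) * B q₁ q₂ where
  measurable := by fun_prop
  bound := by
    refine ⟨C * D, fun f₁ f₂ f₃ h₁ h₂ h₃ => ?_⟩
    have hpair (p : G) : ∫⁻ q : G × G, (B q.1 q.2 * f₃ (p - q.1 - q.2)) ^ 2 ∂(μ.prod μ) ≤
        D * ∫⁻ q, f₃ q ^ 2 ∂μ := by
      simp only [mul_pow]
      rw [lintegral_prod_mul_sub (F := fun q => B q.1 q.2 ^ 2) (f := fun r => f₃ r ^ 2)
        (by fun_prop) (by fun_prop), ← lintegral_const_mul _ (h₃.pow_const 2)]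
      gcongr with r
      exact hD _
    calc ∫⁻ p, trilin μ (fun p q₁ q₂ => A p (p - q₁ - q₂) * B q₁ q₂) f₁ f₂ f₃ p ^ 2 ∂μ
        = ∫⁻ p, (∫⁻ q : G × G, (B q.1 q.2 * f₃ (p - q.1 - q.2)) *
            (A p (p - q.1 - q.2) * (f₁ q.1 * f₂ q.2)) ∂(μ.prod μ)) ^ 2 ∂μ := by
          refine lintegral_congr fun p => congrArg (· ^ 2) (lintegral_congr fun q => ?_)
          ring
      _ ≤ (D * ∫⁻ q, f₃ q ^ 2 ∂μ) * ∫⁻ p, ∫⁻ q : G × G,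
            (A p (p - q.1 - q.2) * (f₁ q.1 * f₂ q.2)) ^ 2 ∂(μ.prod μ) ∂μ :=
          lintegral_lintegral_mul_sq_le
            (f := fun z : G × G × G => B z.2.1 z.2.2 * f₃ (z.1 - z.2.1 - z.2.2))
            (g := fun z : G × G × G => A z.1 (z.1 - z.2.1 - z.2.2) * (f₁ z.2.1 * f₂ z.2.2))
            (by fun_prop) (by fun_prop) hpair
      _ ≤ (D * ∫⁻ q, f₃ q ^ 2 ∂μ) *
            (C * ∫⁻ q : G × G, (f₁ q.1 * f₂ q.2) ^ 2 ∂(μ.prod μ)) := by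
          rw [lintegral_lintegral_swap (by fun_prop)]
          gcongr
          refine lintegral_lintegral_mul_fst_sq_le
            (F := fun z : (G × G) × G => A z.2 (z.2 - z.1.1 - z.1.2)) (by fun_prop) (by fun_prop)
            fun q => ?_
          simpa only [sub_sub] using hC (q.1 + q.2)
      _ = _ := by
          rw [lintegral_prod_mul_sq h₁ h₂, ENNReal.coe_mul]
          ring

end Trilinear

/-! ### Sums over products of frequency differences -/

theorem exists_tsum_decay_mul_decay_linear_le {p q : ℝ} (hp : 0 ≤ p) (hq : 0 ≤ q)
    (hpq : 1 < p + q) :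
    ∃ C : ℝ≥0, ∀ c d : ℝ, 1 ≤ |c| → ∑' n : ℤ, decay p n * decay q (c * n + d) ≤ C := by
  obtain ⟨C, hC⟩ := exists_tsum_decay_linear_le hpq
  refine ⟨C + C, fun c d hc => ?_⟩
  calc ∑' n : ℤ, decay p n * decay q (c * n + d)
      ≤ ∑' n : ℤ, (decay (p + q) (1 * n + 0) + decay (p + q) (c * n + d)) :=
        ENNReal.tsum_le_tsum fun n => by
          simpa only [one_mul, add_zero] using decay_mul_decay_le_add hp hq (n : ℝ) (c * n + d)
    _ ≤ C + C := by
        rw [ENNReal.tsum_add]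
        exact add_le_add (hC 1 0 abs_one.ge) (hC c d hc)

theorem exists_tsum_tsum_decay_mul_decay_product_le {s t q : ℝ} (hs : 1 < s) (ht : 0 ≤ t)
    (hq : 0 ≤ q) (htq : 1 < t + q) :
    ∃ C : ℝ≥0, ∀ (ν : ℝ) (k : ℤ), ∑' m : ℤ, ∑' n : ℤ,
      (if k ≠ m then decay s m * (decay t n * decay q (ν + 2 * (k - m) * (k - n))) else 0)
        ≤ C := by
  obtain ⟨C, hC⟩ := exists_tsum_decay_mul_decay_linear_le ht hq htq
  obtain ⟨D, hD⟩ := exists_tsum_decay_le hs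
  have hsum (ν : ℝ) {k m : ℤ} (hkm : k ≠ m) :
      ∑' n : ℤ, decay t n * decay q (ν + 2 * (k - m) * (k - n)) ≤ C := by
    have hone : (1 : ℝ) ≤ |(k : ℝ) - m| := by
      exact_mod_cast Int.one_le_abs (sub_ne_zero.mpr hkm)
    refine le_trans (ENNReal.tsum_le_tsum fun n => ?_)
      (hC (-(2 * (k - m))) (ν + 2 * (k - m) * k) ?_)
    · rw [show ν + 2 * ((k : ℝ) - m) * (k - n) =
        -(2 * (k - m)) * n + (ν + 2 * (k - m) * k) by ring]
    · rw [abs_neg, abs_mul, abs_two]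
      linarith
  refine ⟨D * C, fun ν k => ?_⟩
  calc _ ≤ ∑' m : ℤ, decay s (m - 0) * C := by
        refine ENNReal.tsum_le_tsum fun m => ?_
        by_cases hkm : k = m
        · simp [hkm]
        · simp only [ne_eq, hkm, not_false_eq_true, if_true, ENNReal.tsum_mul_left, sub_zero]
          gcongr
          exact hsum ν hkm
    _ ≤ D * C := by
        rw [ENNReal.tsum_mul_right]
        gcongr
        exact hD 0
    _ = _ := (ENNReal.coe_mul _ _).symm

theorem exists_tsum_tsum_decay_product_le {p q : ℝ} (hq : 0 ≤ q) (hqp : q ≤ 2 * p)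
    (hpq : 1 < p + q / 2) :
    ∃ C : ℝ≥0, ∀ (ν : ℝ) (k : ℤ), ∑' m : ℤ, ∑' n : ℤ,
      (if k ≠ m ∧ k ≠ n then decay p m * decay p n * decay q (ν + 2 * (k - m) * (k - n)) else 0)
        ≤ C := by
  obtain ⟨C, hC⟩ := exists_tsum_tsum_decay_mul_decay_product_le hpq
    (t := p - q / 2) (by linarith) hq (by linarith)
  refine ⟨C + C, fun ν k => ?_⟩
  calc _ ≤ ∑' m : ℤ, ∑' n : ℤ,
      ((if k ≠ m then decay (p + q / 2) m *
          (decay (p - q / 2) n * decay q (ν + 2 * (k - m) * (k - n))) else 0) +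
        (if k ≠ n then decay (p + q / 2) n *
          (decay (p - q / 2) m * decay q (ν + 2 * (k - n) * (k - m))) else 0)) := by
        refine ENNReal.tsum_le_tsum fun m => ENNReal.tsum_le_tsum fun n => ?_
        by_cases h : k ≠ m ∧ k ≠ n
        · rw [if_pos h, if_pos h.1, if_pos h.2, ← mul_assoc, ← mul_assoc,
            show ν + 2 * ((k : ℝ) - n) * (k - m) = ν + 2 * (k - m) * (k - n) by ring, ← add_mul]
          gcongr
          exact decay_mul_decay_le_of_transfer (by linarith) _ _
        · rw [if_neg h]
          exact zero_le
    _ ≤ C + C := by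
        simp_rw [ENNReal.tsum_add]
        refine add_le_add (hC ν k) ?_
        rw [ENNReal.tsum_comm]
        exact hC ν k

theorem abs_abs_sub_sqrt_le_one {x ν : ℝ} (h : |x ^ 2 - ν| ≤ |x|) : |(|x| - √ν)| ≤ 1 := by
  have hsq : |x ^ 2 - √ν ^ 2| ≤ |x ^ 2 - ν| := by
    rw [Real.sq_sqrt']
    rcases le_total 0 ν with hν | hν
    · rw [max_eq_left hν]
    · rw [max_eq_right hν]
      exact abs_le_abs_of_nonneg (by linarith [sq_nonneg x]) (by linarith)
  have hfactor : |(|x| - √ν)| * (|x| + √ν) = |x ^ 2 - √ν ^ 2| := by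
    conv_lhs => rw [← abs_of_nonneg (show 0 ≤ |x| + √ν by positivity)]
    rw [← abs_mul, ← sq_abs x]
    ring_nf
  have hν := Real.sqrt_nonneg ν
  rcases (add_nonneg (abs_nonneg x) hν).eq_or_lt with h0 | h0
  · rw [show |x| - √ν = 0 by linarith [abs_nonneg x], abs_zero]
    exact zero_le_one
  · refine le_of_mul_le_mul_right ?_ h0
    linarith

theorem one_le_mul_decay_of_abs_le_one {p y : ℝ} (hp : 0 ≤ p) (hy : |y| ≤ 1) :
    1 ≤ ENNReal.ofReal (2 ^ p) * decay p y := by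
  have hbracket : bracket y ≤ 2 * bracket 0 := by
    linarith [bracket_le_one_add_abs y, one_le_bracket 0]
  simpa [decay, bracket] using decay_le_mul_of_bracket_le hp two_pos hbracket

theorem exists_tsum_indicator_sq_sub_le :
    ∃ C : ℝ≥0, ∀ ν : ℝ,
      ∑' m : ℤ, (if |(m : ℝ) ^ 2 - ν| ≤ |(m : ℝ)| then (1 : ℝ≥0∞) else 0) ≤ C := by
  obtain ⟨C, hC⟩ := exists_tsum_decay_le one_lt_two
  refine ⟨((2 : ℝ) ^ (2 : ℝ)).toNNReal * (C + C), fun ν => ?_⟩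
  calc ∑' m : ℤ, (if |(m : ℝ) ^ 2 - ν| ≤ |(m : ℝ)| then (1 : ℝ≥0∞) else 0)
      ≤ ∑' m : ℤ, ENNReal.ofReal (2 ^ (2 : ℝ)) * (decay 2 (m - √ν) + decay 2 (m - -√ν)) := by
        refine ENNReal.tsum_le_tsum fun m => ?_
        split_ifs with h
        · refine (one_le_mul_decay_of_abs_le_one zero_le_two (abs_abs_sub_sqrt_le_one h)).trans ?_
          gcongr
          rcases abs_choice (m : ℝ) with hm | hm <;> rw [hm]
          · exact le_self_add
          · rw [← decay_neg, neg_sub', neg_neg]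
            exact le_add_self
        · exact zero_le
    _ = ENNReal.ofReal (2 ^ (2 : ℝ)) *
          (∑' m : ℤ, decay 2 (m - √ν) + ∑' m : ℤ, decay 2 (m - -√ν)) := by
        rw [ENNReal.tsum_mul_left, ENNReal.tsum_add]
    _ ≤ ENNReal.ofReal (2 ^ (2 : ℝ)) * (C + C) := by gcongr <;> exact hC _
    _ = _ := by push_cast; rfl

/-- The input frequencies `m`, `n` are small compared with the output frequency `k`. The powers
are chosen such that `m` and `n` are negligible in the factors of the resonance function
`2 (k - m) (k - n)`. -/
def IsSmallPair (k m n : ℤ) : Prop := 16 * (bracket m * bracket n) ^ 2 ≤ bracket k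

theorem IsSmallPair.sq_sub_le {k m n : ℤ} (h : IsSmallPair k m n) :
    ((m : ℝ) - n) ^ 2 + 2 * bracket n ≤ |2 * (k : ℝ) - m - n| := by
  unfold IsSmallPair at h
  have hm : bracket m ≤ bracket m * bracket n :=
    le_mul_of_one_le_right (bracket_pos _).le (one_le_bracket _)
  have hn : bracket n ≤ bracket m * bracket n :=
    le_mul_of_one_le_left (bracket_pos _).le (one_le_bracket _)
  set x := bracket m * bracket n
  have hx : 1 ≤ x := (one_le_bracket _).trans hm
  have hmx := (abs_le_bracket (m : ℝ)).trans hm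
  have hnx := (abs_le_bracket (n : ℝ)).trans hn
  have hsq : ((m : ℝ) - n) ^ 2 ≤ (2 * x) ^ 2 := by
    rw [← sq_abs]
    gcongr
    linarith [abs_sub (m : ℝ) n]
  have hk : 2 * |(k : ℝ)| ≤ |2 * (k : ℝ) - m - n| + (|(m : ℝ)| + |(n : ℝ)|) := by
    calc 2 * |(k : ℝ)| = |(2 * (k : ℝ) - m - n) + (m + n)| := by
          rw [← abs_two, ← abs_mul]
          ring_nf
      _ ≤ _ := (abs_add_le _ _).trans (by gcongr; exact abs_add_le _ _)
  nlinarith [bracket_le_one_add_abs (k : ℝ)]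

/-- If the resonance function does not dominate `n`, then `(2k - m - n)² + 2ν` is small, which
leaves boundedly many values of `2k - m - n`. -/
theorem IsSmallPair.decay_mul_decay_le {k m n : ℤ} (h : IsSmallPair k m n) {q r : ℝ} (hr : r ≤ q)
    (ν : ℝ) :
    decay 1 n * decay q (ν + 2 * (k - m) * (k - n)) ≤
      decay (1 + (q - r)) n * decay r (ν + 2 * (k - m) * (k - n)) +
      (if |(2 * (k : ℝ) - m - n) ^ 2 - -(2 * ν)| ≤ |2 * (k : ℝ) - m - n| then
        decay r (ν + 2 * (k - m) * (k - n)) else 0) := by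
  set Z := ν + 2 * ((k : ℝ) - m) * (k - n) with hZ
  split_ifs with hres
  · refine le_trans ?_ le_add_self
    calc decay 1 n * decay q Z ≤ 1 * decay r Z :=
          mul_le_mul' (decay_le_one zero_le_one _) (decay_le_decay_exponent hr _)
      _ = decay r Z := one_mul _
  · have hnZ : bracket n ≤ bracket Z := by
      refine le_trans ?_ (abs_le_bracket Z)
      by_contra! hlt
      refine hres ?_
      calc |(2 * (k : ℝ) - m - n) ^ 2 - -(2 * ν)| = |2 * Z + ((m : ℝ) - n) ^ 2| := by
            rw [hZ]
            ring_nf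
        _ ≤ |2 * Z| + |((m : ℝ) - n) ^ 2| := abs_add_le _ _
        _ = 2 * |Z| + ((m : ℝ) - n) ^ 2 := by rw [abs_mul, abs_two, abs_sq]
        _ ≤ |2 * (k : ℝ) - m - n| := by linarith [h.sq_sub_le]
    calc decay 1 n * decay q Z = decay 1 n * (decay (q - r) Z * decay r Z) := by
          rw [decay_mul_decay, sub_add_cancel]
      _ ≤ decay 1 n * (decay (q - r) n * decay r Z) := by
          gcongr
          exact decay_le_of_bracket_le (sub_nonneg.mpr hr) hnZ
      _ = decay (1 + (q - r)) n * decay r Z + 0 := by rw [← mul_assoc, decay_mul_decay, add_zero]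

theorem exists_tsum_tsum_decay_product_nonresonant_le {s r : ℝ} (hs : 1 < s) (hr : 1 / 2 < r) :
    ∃ C : ℝ≥0, ∀ (ν : ℝ) (m : ℤ), ∑' k : ℤ, ∑' n : ℤ,
      decay s n * decay r (ν + 2 * (k - m) * (k - n)) ≤ C := by
  obtain ⟨C, hC⟩ := exists_tsum_decay_quadratic_le hr two_ne_zero
  obtain ⟨D, hD⟩ := exists_tsum_decay_le hs
  refine ⟨D * C, fun ν m => ?_⟩
  calc ∑' k : ℤ, ∑' n : ℤ, decay s n * decay r (ν + 2 * (k - m) * (k - n))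
      = ∑' n : ℤ, decay s (n - 0) *
          ∑' k : ℤ, decay r (2 * (k : ℝ) ^ 2 + -2 * (m + n) * k + (ν + 2 * m * n)) := by
        rw [ENNReal.tsum_comm]
        refine tsum_congr fun n => ?_
        rw [← ENNReal.tsum_mul_left, sub_zero]
        refine tsum_congr fun k => ?_
        ring_nf
    _ ≤ ∑' n : ℤ, decay s (n - 0) * C := by
        gcongr
        exact hC _ _
    _ ≤ D * C := by
        rw [ENNReal.tsum_mul_right]
        gcongr
        exact hD 0
    _ = _ := (ENNReal.coe_mul _ _).symm

theorem exists_tsum_tsum_decay_product_resonant_le {r : ℝ} (hr : 1 / 2 < r) :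
    ∃ C : ℝ≥0, ∀ (ν : ℝ) (m : ℤ), ∑' k : ℤ, ∑' n : ℤ,
      (if |(2 * (k : ℝ) - m - n) ^ 2 - -(2 * ν)| ≤ |2 * (k : ℝ) - m - n| then
        decay r (ν + 2 * (k - m) * (k - n)) else 0) ≤ C := by
  obtain ⟨C, hC⟩ := exists_tsum_decay_quadratic_le hr (a := -1 / 2) (by norm_num)
  obtain ⟨D, hD⟩ := exists_tsum_indicator_sq_sub_le
  refine ⟨D * C, fun ν m => ?_⟩
  let F (n l : ℤ) : ℝ≥0∞ := (if |(l : ℝ) ^ 2 - -(2 * ν)| ≤ |(l : ℝ)| then 1 else 0) *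
    decay r (-1 / 2 * (n : ℝ) ^ 2 + m * n + (ν + l ^ 2 / 2 - m ^ 2 / 2))
  calc _ = ∑' n : ℤ, ∑' k : ℤ, F n (2 * k - m - n) := by
        rw [ENNReal.tsum_comm]
        refine tsum_congr fun n => tsum_congr fun k => ?_
        simp only [F, ite_mul, one_mul, zero_mul]
        push_cast
        ring_nf
    _ ≤ ∑' n : ℤ, ∑' l : ℤ, F n l := by
        refine ENNReal.tsum_le_tsum fun n => ?_
        exact ENNReal.tsum_comp_le_tsum_of_injective
          (fun k k' (hk : 2 * k - m - n = 2 * k' - m - n) => by lia) (F n)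
    _ ≤ ∑' l : ℤ, (if |(l : ℝ) ^ 2 - -(2 * ν)| ≤ |(l : ℝ)| then 1 else 0) * (C : ℝ≥0∞) := by
        rw [ENNReal.tsum_comm]
        simp_rw [F, ENNReal.tsum_mul_left]
        gcongr
        exact hC _ _
    _ ≤ D * C := by
        rw [ENNReal.tsum_mul_right]
        gcongr
        exact hD _
    _ = _ := (ENNReal.coe_mul _ _).symm

open Classical in
theorem exists_tsum_tsum_smallPair_le {q : ℝ} (hq : 1 / 2 < q) :
    ∃ C : ℝ≥0, ∀ (ν : ℝ) (m : ℤ), ∑' k : ℤ, ∑' n : ℤ,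
      (if IsSmallPair k m n then decay 1 n * decay q (ν + 2 * (k - m) * (k - n)) else 0) ≤ C := by
  obtain ⟨r, hr, hrq⟩ := exists_between hq
  obtain ⟨C, hC⟩ :=
    exists_tsum_tsum_decay_product_nonresonant_le (s := 1 + (q - r)) (by linarith) hr
  obtain ⟨D, hD⟩ := exists_tsum_tsum_decay_product_resonant_le hr
  refine ⟨C + D, fun ν m => ?_⟩
  rw [ENNReal.coe_add]
  refine le_trans ?_ (add_le_add (hC ν m) (hD ν m))
  simp_rw [← ENNReal.tsum_add]
  refine ENNReal.tsum_le_tsum fun k => ENNReal.tsum_le_tsum fun n => ?_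
  by_cases h : IsSmallPair k m n
  · rw [if_pos h]
    exact h.decay_mul_decay_le hrq.le ν
  · rw [if_neg h]
    exact zero_le

/-! ### Frequency space -/

/-- The product of Lebesgue and counting measure on the frequency space `ℝ × ℤ`, the dual group of
`ℝ × 𝕋`. -/
noncomputable abbrev freqMeasure : Measure (ℝ × ℤ) := (volume : Measure ℝ).prod Measure.count

instance : freqMeasure.IsNegInvariant where
  neg_eq_self := by
    have h := Measure.map_prod_map (volume : Measure ℝ) (Measure.count : Measure ℤ)
      measurable_neg measurable_neg
    rw [Measure.map_neg_eq_self, Measure.map_neg_eq_self] at h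
    exact h.symm

theorem lintegral_freqMeasure {f : ℝ × ℤ → ℝ≥0∞} (hf : Measurable f) :
    ∫⁻ q, f q ∂freqMeasure = ∑' ξ : ℤ, ∫⁻ τ : ℝ, f (τ, ξ) := by
  rw [lintegral_prod_symm _ hf.aemeasurable, lintegral_count]

theorem lintegral_freqMeasure_prod {f : (ℝ × ℤ) × (ℝ × ℤ) → ℝ≥0∞} (hf : Measurable f) :
    ∫⁻ q, f q ∂(freqMeasure.prod freqMeasure) =
      ∑' m : ℤ, ∑' n : ℤ, ∫⁻ σ : ℝ, ∫⁻ τ : ℝ, f ((σ, m), (τ, n)) := by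
  rw [lintegral_prod _ hf.aemeasurable, lintegral_freqMeasure hf.lintegral_prod_right']
  refine tsum_congr fun m => ?_
  calc ∫⁻ σ : ℝ, ∫⁻ q, f ((σ, m), q) ∂freqMeasure
      = ∫⁻ σ : ℝ, ∑' n : ℤ, ∫⁻ τ : ℝ, f ((σ, m), (τ, n)) :=
        lintegral_congr fun σ => lintegral_freqMeasure (by fun_prop)
    _ = ∑' n : ℤ, ∫⁻ σ : ℝ, ∫⁻ τ : ℝ, f ((σ, m), (τ, n)) := by
        refine lintegral_tsum fun n => Measurable.aemeasurable ?_
        exact Measurable.lintegral_prod_right' (f := fun z : ℝ × ℝ => f ((z.1, m), (z.2, n)))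
          (by fun_prop)

@[fun_prop]
theorem measurable_intCast_real : Measurable (Int.cast : ℤ → ℝ) := .of_discrete

theorem exists_lintegral_freqMeasure_decay_le {α β γ : ℝ} (hγ : 0 ≤ γ) (hα : γ ≤ α) (hβ : γ ≤ β)
    (h : 1 < α + β - γ) :
    ∃ C : ℝ≥0, ∀ a b : ℤ → ℝ,
      ∫⁻ q : ℝ × ℤ, decay α (q.1 - a q.2) * decay β (q.1 - b q.2) ∂freqMeasure ≤
        C * ∑' n : ℤ, decay γ (a n - b n) := by
  obtain ⟨C, hC⟩ := exists_lintegral_decay_mul_decay_le hγ hα hβ h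
  refine ⟨C, fun a b => ?_⟩
  have ha : Measurable a := .of_discrete
  have hb : Measurable b := .of_discrete
  have hmeas : Measurable fun q : ℝ × ℤ => decay α (q.1 - a q.2) * decay β (q.1 - b q.2) := by
    fun_prop
  calc ∫⁻ q : ℝ × ℤ, decay α (q.1 - a q.2) * decay β (q.1 - b q.2) ∂freqMeasure
      = ∑' n : ℤ, ∫⁻ τ : ℝ, decay α (τ - a n) * decay β (τ - b n) := lintegral_freqMeasure hmeas
    _ ≤ ∑' n : ℤ, C * decay γ (a n - b n) := ENNReal.tsum_le_tsum fun n => hC (a n) (b n)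
    _ = C * ∑' n : ℤ, decay γ (a n - b n) := ENNReal.tsum_mul_left

theorem exists_lintegral_freqMeasure_prod_mul_decay_le {α δ : ℝ} (hδ : 0 ≤ δ) (hδα : δ ≤ α)
    (h : δ + 2 < 3 * α) :
    ∃ C : ℝ≥0, ∀ (w : ℤ → ℤ → ℝ≥0∞) (a b : ℤ → ℝ) (c : ℤ → ℤ → ℝ),
      ∫⁻ q, w q.1.2 q.2.2 * (decay α (q.1.1 - a q.1.2) * decay α (q.2.1 - b q.2.2) *
        decay α (q.1.1 + q.2.1 - c q.1.2 q.2.2)) ∂(freqMeasure.prod freqMeasure) ≤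
        C * ∑' m, ∑' n, w m n * decay δ (a m + b n - c m n) := by
  obtain ⟨C, hC⟩ := exists_lintegral_lintegral_decay_le hδ hδα h
  refine ⟨C, fun w a b c => ?_⟩
  have hw : Measurable (Function.uncurry w) := .of_discrete
  have ha : Measurable a := .of_discrete
  have hb : Measurable b := .of_discrete
  have hc : Measurable (Function.uncurry c) := .of_discrete
  rw [lintegral_freqMeasure_prod (by fun_prop)]
  simp_rw [← ENNReal.tsum_mul_left]
  refine ENNReal.tsum_le_tsum fun m => ENNReal.tsum_le_tsum fun n => ?_
  let F (σ τ : ℝ) := decay α (σ - a m) * decay α (τ - b n) * decay α (σ + τ - c m n)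
  calc ∫⁻ σ, ∫⁻ τ, w m n * F σ τ = w m n * ∫⁻ σ, ∫⁻ τ, F σ τ := by
        have hF : Measurable fun z : ℝ × ℝ => F z.1 z.2 := by fun_prop
        rw [← lintegral_const_mul _ hF.lintegral_prod_right]
        exact lintegral_congr fun σ => lintegral_const_mul _ (by fun_prop)
    _ ≤ w m n * (C * decay δ (a m + b n - c m n)) := by
        gcongr
        exact hC _ _ _
    _ = _ := by ring

/-- The modulation `τ + ξ²`. -/
def modP (q : ℝ × ℤ) : ℝ := q.1 + (q.2 : ℝ) ^ 2

/-- The modulation `τ - ξ²`. -/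
def modM (q : ℝ × ℤ) : ℝ := q.1 - (q.2 : ℝ) ^ 2

@[fun_prop]
theorem measurable_modP : Measurable modP := by
  unfold modP
  fun_prop

@[fun_prop]
theorem measurable_modM : Measurable modM := by
  unfold modM
  fun_prop

theorem modM_sub_comm (q r : ℝ × ℤ) : modM (q - r) = -modP (r - q) := by
  simp only [modM, modP, Prod.fst_sub, Prod.snd_sub, Int.cast_sub]
  ring

theorem exists_lintegral_decay_modP_mul_decay_modM_le {α : ℝ} (hα : 3 / 4 < α) :
    ∃ C : ℝ≥0, ∀ r, ∫⁻ p, decay α (modP p) * decay α (modM (p - r)) ∂freqMeasure ≤ C := by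
  obtain ⟨γ, hγ, hγα⟩ := exists_between (show 1 / 2 < min α (2 * α - 1) by
    rw [lt_min_iff]; constructor <;> linarith)
  rw [lt_min_iff] at hγα
  obtain ⟨C, hC⟩ := exists_lintegral_freqMeasure_decay_le (α := α) (β := α) (γ := γ)
    (by linarith) hγα.1.le hγα.1.le (by linarith)
  obtain ⟨D, hD⟩ := exists_tsum_decay_quadratic_le hγ (a := -2) (by norm_num)
  refine ⟨C * D, fun r => ?_⟩
  calc ∫⁻ p, decay α (modP p) * decay α (modM (p - r)) ∂freqMeasure
      = ∫⁻ p : ℝ × ℤ, decay α (p.1 - -(p.2 : ℝ) ^ 2) *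
          decay α (p.1 - (r.1 + ((p.2 : ℝ) - r.2) ^ 2)) ∂freqMeasure := by
        refine lintegral_congr fun p => ?_
        simp only [modP, modM, Prod.fst_sub, Prod.snd_sub, Int.cast_sub]
        ring_nf
    _ ≤ C * ∑' n : ℤ, decay γ (-(n : ℝ) ^ 2 - (r.1 + ((n : ℝ) - r.2) ^ 2)) :=
        hC (fun n => -(n : ℝ) ^ 2) fun n => r.1 + ((n : ℝ) - r.2) ^ 2
    _ = C * ∑' n : ℤ, decay γ (-2 * (n : ℝ) ^ 2 + 2 * r.2 * n + -(r.1 + (r.2 : ℝ) ^ 2)) := by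
        refine congrArg _ (tsum_congr fun n => congrArg _ ?_)
        ring
    _ ≤ C * D := by
        gcongr
        exact hD _ _
    _ = _ := (ENNReal.coe_mul _ _).symm

/-! ### The trilinear kernels -/

/-- The factor of a kernel that couples the output `p` with the third input `q₃`. Here, as in the
kernels below, the modulation exponent is slightly less than `1/2`; the difference is later traded
for a positive power of `T`. -/
noncomputable def outThird (p q₃ : ℝ × ℤ) : ℝ≥0∞ :=
  decay (31 / 64) (modP p) * decay (31 / 64) (modM q₃)

@[fun_prop]
theorem measurable_outThird : Measurable (Function.uncurry outThird) := by
  unfold outThird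
  fun_prop

theorem exists_lintegral_outThird_sq_le :
    ∃ C : ℝ≥0, ∀ r, ∫⁻ p, outThird p (p - r) ^ 2 ∂freqMeasure ≤ C := by
  obtain ⟨C, hC⟩ := exists_lintegral_decay_modP_mul_decay_modM_le (α := 2 * (31 / 64))
    (by norm_num)
  refine ⟨C, fun r => ?_⟩
  simpa only [outThird, mul_pow, decay_sq] using hC r

/-- The kernel in the range where the derivative falls on a comparatively low frequency, that is
`⟨ξ⟩⟨ξ₃⟩ ≤ 4⟨ξ₁⟩⟨ξ₂⟩`. -/
noncomputable def kerLow (p q₁ q₂ : ℝ × ℤ) : ℝ≥0∞ :=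
  outThird p (p - q₁ - q₂) * (decay (31 / 64) (modP q₁) * decay (31 / 64) (modP q₂))

theorem isL2Kernel_kerLow : IsL2Kernel freqMeasure kerLow := by
  obtain ⟨C, hC⟩ := exists_lintegral_outThird_sq_le
  refine isL2Kernel_of_pairs (A := outThird)
    (B := fun q₁ q₂ => decay (31 / 64) (modP q₁) * decay (31 / 64) (modP q₂))
    measurable_outThird (by fun_prop) C C hC fun r => ?_
  simpa only [outThird, modM_sub_comm, decay_neg] using hC r

/-- The kernel in the range where the first modulation dominates and the first two frequencies are
comparatively large. -/
noncomputable def kerFirst (p q₁ q₂ : ℝ × ℤ) : ℝ≥0∞ :=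
  outThird p (p - q₁ - q₂) *
    (decay (11 / 32) q₁.2 * decay (11 / 32) q₂.2 * decay (33 / 64) (modP q₂))

theorem exists_lintegral_decay_freq_mul_decay_modM_le {p q : ℝ} (hp : 1 / 2 < p) (hq : 1 < q) :
    ∃ C : ℝ≥0, ∀ r : ℝ × ℤ,
      ∫⁻ z, decay p z.2 * decay p (r.2 - z.2 : ℤ) * decay q (modM (z - r)) ∂freqMeasure ≤ C := by
  obtain ⟨C, hC⟩ := exists_lintegral_decay_le hq
  obtain ⟨D, hD⟩ := exists_tsum_decay_le (p := p + p) (by linarith)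
  refine ⟨(D + D) * C, fun r => ?_⟩
  rw [lintegral_freqMeasure (by fun_prop)]
  calc ∑' n : ℤ, ∫⁻ x : ℝ, decay p n * decay p (r.2 - n : ℤ) * decay q (modM ((x, n) - r))
      = ∑' n : ℤ, decay p n * decay p (n - r.2) *
          ∫⁻ x, decay q (x - (r.1 + ((n : ℝ) - r.2) ^ 2)) := by
        refine tsum_congr fun n => ?_
        rw [lintegral_const_mul _ (by fun_prop), Int.cast_sub, decay_sub_comm]
        simp only [modM, Prod.fst_sub, Prod.snd_sub, Int.cast_sub, sub_sub]
    _ ≤ ∑' n : ℤ, (decay (p + p) (n - 0) + decay (p + p) (n - r.2)) * C := by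
        gcongr with n
        · rw [sub_zero]
          exact decay_mul_decay_le_add (by linarith) (by linarith) _ _
        · exact hC _
    _ ≤ (D + D) * C := by
        rw [ENNReal.tsum_mul_right, ENNReal.tsum_add]
        gcongr <;> exact hD _
    _ = _ := by push_cast; rfl

theorem isL2Kernel_kerFirst : IsL2Kernel freqMeasure kerFirst := by
  obtain ⟨C, hC⟩ := exists_lintegral_outThird_sq_le
  obtain ⟨D, hD⟩ := exists_lintegral_decay_freq_mul_decay_modM_le (p := 2 * (11 / 32))
    (q := 2 * (33 / 64)) (by norm_num) (by norm_num)
  refine isL2Kernel_of_pairs (A := outThird)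
    (B := fun q₁ q₂ => decay (11 / 32) q₁.2 * decay (11 / 32) q₂.2 * decay (33 / 64) (modP q₂))
    measurable_outThird (by fun_prop) C D hC fun r => ?_
  simpa only [mul_pow, decay_sq, modM_sub_comm, decay_neg, Prod.snd_sub] using hD r

theorem measurable_comp_three_freq (w : ℤ → ℤ → ℤ → ℝ≥0∞) :
    Measurable fun z : (ℝ × ℤ) × (ℝ × ℤ) × (ℝ × ℤ) => w z.1.2 z.2.1.2 z.2.2.2 :=
  (Measurable.of_discrete (f := fun t : ℤ × ℤ × ℤ => w t.1 t.2.1 t.2.2)).comp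
    (g := fun t : ℤ × ℤ × ℤ => w t.1 t.2.1 t.2.2)
    (f := fun z : (ℝ × ℤ) × (ℝ × ℤ) × (ℝ × ℤ) => (z.1.2, z.2.1.2, z.2.2.2)) (by fun_prop)

/-- The frequency weight of the kernels for a dominating output or third modulation. It vanishes on
the resonant set `k = m` or `k = n`. -/
noncomputable def nonresonantWeight (k m n : ℤ) : ℝ≥0∞ :=
  if k ≠ m ∧ k ≠ n then decay (27 / 64) m * decay (27 / 64) n else 0

theorem exists_tsum_tsum_nonresonantWeight_sq_le :
    ∃ C : ℝ≥0, ∀ (ν : ℝ) (k : ℤ), ∑' m : ℤ, ∑' n : ℤ,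
      nonresonantWeight k m n ^ 2 * decay (5 / 8) (ν + 2 * (k - m) * (k - n)) ≤ C := by
  obtain ⟨C, hC⟩ := exists_tsum_tsum_decay_product_le (p := 2 * (27 / 64)) (q := 5 / 8)
    (by norm_num) (by norm_num) (by norm_num)
  refine ⟨C, fun ν k => (tsum_congr fun m => tsum_congr fun n => ?_).trans_le (hC ν k)⟩
  simp only [nonresonantWeight, ite_pow, mul_pow, decay_sq, ne_eq, OfNat.ofNat_ne_zero,
    not_false_eq_true, zero_pow, ite_mul, zero_mul]

/-- The kernel in the range where the output modulation dominates. -/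
noncomputable def kerOut (p q₁ q₂ : ℝ × ℤ) : ℝ≥0∞ :=
  nonresonantWeight p.2 q₁.2 q₂.2 *
    (decay (31 / 64) (modP q₁) * decay (31 / 64) (modP q₂) * decay (31 / 64) (modM (p - q₁ - q₂)))

theorem isL2Kernel_kerOut : IsL2Kernel freqMeasure kerOut := by
  obtain ⟨C, hC⟩ := exists_lintegral_freqMeasure_prod_mul_decay_le (α := 2 * (31 / 64))
    (δ := 5 / 8) (by norm_num) (by norm_num) (by norm_num)
  obtain ⟨D, hD⟩ := exists_tsum_tsum_nonresonantWeight_sq_le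
  refine isL2Kernel_of_output ((measurable_comp_three_freq nonresonantWeight).mul (by fun_prop))
    (C * D) fun p => ?_
  refine (lintegral_congr fun q => ?_).trans_le ((hC (fun m n => nonresonantWeight p.2 m n ^ 2)
    (fun m => -(m : ℝ) ^ 2) (fun n => -(n : ℝ) ^ 2)
    fun m n => p.1 - ((p.2 : ℝ) - m - n) ^ 2).trans ?_)
  · have hmod : modM (p - q.1 - q.2) =
        -(q.1.1 + q.2.1 - (p.1 - ((p.2 : ℝ) - q.1.2 - q.2.2) ^ 2)) := by
      simp only [modM, Prod.fst_sub, Prod.snd_sub, Int.cast_sub]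
      ring
    simp only [kerOut, mul_pow, decay_sq, hmod, decay_neg, modP, sub_neg_eq_add]
  · rw [ENNReal.coe_mul]
    gcongr
    refine (tsum_congr fun m => tsum_congr fun n => ?_).trans_le
      (hD (-(p.1 + (p.2 : ℝ) ^ 2)) p.2)
    ring_nf

/-- The kernel in the range where the third modulation dominates. -/
noncomputable def kerThird (p q₁ q₂ : ℝ × ℤ) : ℝ≥0∞ :=
  nonresonantWeight p.2 q₁.2 q₂.2 *
    (decay (31 / 64) (modP q₁) * decay (31 / 64) (modP q₂) * decay (31 / 64) (modP p))

theorem nonresonantWeight_add_add (l m n : ℤ) :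
    nonresonantWeight (l + (m + n)) m n = nonresonantWeight (-l) m n := by
  have h : l + (m + n) ≠ m ∧ l + (m + n) ≠ n ↔ -l ≠ m ∧ -l ≠ n := by lia
  simp only [nonresonantWeight, h]

theorem isL2Kernel_kerThird : IsL2Kernel freqMeasure kerThird := by
  obtain ⟨C, hC⟩ := exists_lintegral_freqMeasure_prod_mul_decay_le (α := 2 * (31 / 64))
    (δ := 5 / 8) (by norm_num) (by norm_num) (by norm_num)
  obtain ⟨D, hD⟩ := exists_tsum_tsum_nonresonantWeight_sq_le
  refine isL2Kernel_of_third ((measurable_comp_three_freq nonresonantWeight).mul (by fun_prop))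
    (C * D) fun r => ?_
  refine (lintegral_congr fun q => ?_).trans_le ((hC (fun m n => nonresonantWeight (-r.2) m n ^ 2)
    (fun m => -(m : ℝ) ^ 2) (fun n => -(n : ℝ) ^ 2)
    fun m n => -(r.1 + ((r.2 : ℝ) + m + n) ^ 2)).trans ?_)
  · have hmod : modP (r + (q.1 + q.2)) =
        q.1.1 + q.2.1 - -(r.1 + ((r.2 : ℝ) + q.1.2 + q.2.2) ^ 2) := by
      simp only [modP, Prod.fst_add, Prod.snd_add, Int.cast_add]
      ring
    simp only [kerThird, Prod.snd_add, nonresonantWeight_add_add, mul_pow, decay_sq, hmod]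
    simp only [modP, sub_neg_eq_add]
  · rw [ENNReal.coe_mul]
    gcongr
    refine (tsum_congr fun m => tsum_congr fun n => ?_).trans_le
      (hD (r.1 - (r.2 : ℝ) ^ 2) (-r.2))
    push_cast
    ring_nf

open Classical in
/-- The frequency weight of the kernel for a dominating first modulation and comparatively small
first two frequencies. -/
noncomputable def smallPairWeight (k m n : ℤ) : ℝ≥0∞ :=
  if IsSmallPair k m n then decay (1 / 2) n else 0

theorem exists_tsum_tsum_smallPairWeight_sq_le {q : ℝ} (hq : 1 / 2 < q) :
    ∃ C : ℝ≥0, ∀ (ν : ℝ) (m : ℤ), ∑' k : ℤ, ∑' n : ℤ,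
      smallPairWeight k m n ^ 2 * decay q (ν + 2 * (k - m) * (k - n)) ≤ C := by
  obtain ⟨C, hC⟩ := exists_tsum_tsum_smallPair_le hq
  refine ⟨C, fun ν m => (tsum_congr fun k => tsum_congr fun n => ?_).trans_le (hC ν m)⟩
  have htwo : (2 : ℝ) * (1 / 2) = 1 := by norm_num
  simp only [smallPairWeight, ite_pow, decay_sq, htwo, ne_eq, OfNat.ofNat_ne_zero,
    not_false_eq_true, zero_pow, ite_mul, zero_mul]

/-- The kernel in the range where the first modulation dominates and the first two frequencies are
comparatively small. -/
noncomputable def kerSmall (p q₁ q₂ : ℝ × ℤ) : ℝ≥0∞ :=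
  smallPairWeight p.2 q₁.2 q₂.2 *
    (decay (31 / 64) (modP p) * decay (31 / 64) (modP q₂) * decay (31 / 64) (modM (p - q₁ - q₂)))

theorem isL2Kernel_kerSmall : IsL2Kernel freqMeasure kerSmall := by
  obtain ⟨C, hC⟩ := exists_lintegral_freqMeasure_prod_mul_decay_le (α := 2 * (31 / 64))
    (δ := 5 / 8) (by norm_num) (by norm_num) (by norm_num)
  obtain ⟨D, hD⟩ := exists_tsum_tsum_smallPairWeight_sq_le (q := 5 / 8) (by norm_num)
  refine isL2Kernel_of_first ((measurable_comp_three_freq smallPairWeight).mul (by fun_prop))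
    (C * D) fun r => ?_
  refine (lintegral_congr fun q => ?_).trans_le
    ((hC (fun n l => smallPairWeight (l + (r.2 + n)) r.2 n ^ 2)
      (fun n => -(n : ℝ) ^ 2) (fun l => (l : ℝ) ^ 2)
      fun n l => -(r.1 + ((l : ℝ) + r.2 + n) ^ 2)).trans ?_)
  · have hmod : modP (q.2 + (r + q.1)) =
        q.1.1 + q.2.1 - -(r.1 + ((q.2.2 : ℝ) + r.2 + q.1.2) ^ 2) := by
      simp only [modP, Prod.fst_add, Prod.snd_add, Int.cast_add]
      ring
    have hthird : q.2 + (r + q.1) - r - q.1 = q.2 := by abel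
    simp only [kerSmall, hthird, Prod.snd_add, mul_pow, decay_sq, hmod]
    simp only [modP, modM, sub_neg_eq_add]
    ring
  · rw [ENNReal.coe_mul]
    gcongr
    refine le_trans (le_of_eq ?_) (hD (r.1 + (r.2 : ℝ) ^ 2) r.2)
    refine Eq.trans (tsum_congr fun n => ?_) ENNReal.tsum_comm
    refine Eq.trans (tsum_congr fun l => ?_) ((Equiv.addRight (r.2 + n)).tsum_eq _)
    simp only [Equiv.coe_addRight]
    push_cast
    ring_nf

/-! ### Arithmetic of the resonance function -/

theorem bracket_intCast_sq_le {n : ℤ} (hn : n ≠ 0) : bracket n ^ 2 ≤ 2 * (n : ℝ) ^ 2 := by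
  have h : (1 : ℝ) ≤ (n : ℝ) ^ 2 := by exact_mod_cast Int.add_one_le_of_lt (sq_pos_of_ne_zero hn)
  rw [bracket_sq]
  linarith

theorem bracket_mul_bracket_intCast_le {k l : ℤ} (hk : k ≠ 0) (hl : l ≠ 0) :
    bracket k * bracket l ≤ 2 * |(k : ℝ) * l| := by
  refine le_of_sq_le_sq ?_ (by positivity)
  calc (bracket k * bracket l) ^ 2 = bracket k ^ 2 * bracket l ^ 2 := mul_pow _ _ _
    _ ≤ (2 * (k : ℝ) ^ 2) * (2 * (l : ℝ) ^ 2) := by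
        gcongr
        exacts [bracket_intCast_sq_le hk, bracket_intCast_sq_le hl]
    _ = (2 * |(k : ℝ) * l|) ^ 2 := by
        rw [mul_pow, sq_abs]
        ring

theorem bracket_add_le_two_mul_bracket_mul (x y : ℝ) :
    bracket (x + y) ≤ 2 * (bracket x * bracket y) := by
  have hx := one_le_bracket x
  have hy := one_le_bracket y
  nlinarith [bracket_add_le x y, mul_nonneg (sub_nonneg.mpr hx) (sub_nonneg.mpr hy)]

theorem bracket_mul_bracket_sub_sub_le (k m n : ℤ) :
    bracket k * bracket (k - m - n : ℤ) ≤
      2 * |((k : ℝ) - m) * (k - n)| + 2 * (bracket m * bracket n) := by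
  have hres := abs_nonneg (((k : ℝ) - m) * (k - n))
  have hsum := bracket_add_le_two_mul_bracket_mul (m : ℝ) n
  have hone : bracket (0 : ℤ) = 1 := by simp [bracket]
  rcases eq_or_ne k 0 with rfl | hk
  · have h : bracket (0 - m - n : ℤ) = bracket ((m : ℝ) + n) := by
      rw [← bracket_neg]
      push_cast
      ring_nf
    rw [hone, one_mul, h]
    linarith
  rcases eq_or_ne (k - m - n) 0 with hl | hl
  · have h : (k : ℝ) = m + n := by
      rw [sub_sub, sub_eq_zero] at hl
      exact_mod_cast hl
    rw [hl, hone, mul_one, h]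
    rw [h] at hres
    linarith
  · have habs : |(m : ℝ) * n| ≤ bracket m * bracket n := by
      rw [abs_mul]
      exact mul_le_mul (abs_le_bracket _) (abs_le_bracket _) (abs_nonneg _) (bracket_pos _).le
    calc bracket k * bracket (k - m - n : ℤ)
        ≤ 2 * |(k : ℝ) * (k - m - n : ℤ)| := bracket_mul_bracket_intCast_le hk hl
      _ = 2 * |((k : ℝ) - m) * (k - n) - (m : ℝ) * n| := by
          push_cast
          ring_nf
      _ ≤ 2 * (|((k : ℝ) - m) * (k - n)| + |(m : ℝ) * n|) := by
          gcongr
          exact abs_sub _ _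
      _ ≤ _ := by linarith

theorem bracket_sub_sub_le (k m n : ℤ) :
    bracket (k - m - n : ℤ) ≤ bracket k + 2 * (bracket m * bracket n) := by
  have h := bracket_add_le (k : ℝ) (-(m + n))
  rw [bracket_neg] at h
  push_cast
  rw [sub_sub, sub_eq_add_neg]
  exact h.trans (by gcongr; exact bracket_add_le_two_mul_bracket_mul _ _)

theorem one_le_bracket_mul_bracket (x y : ℝ) : 1 ≤ bracket x * bracket y :=
  one_le_mul_of_one_le_of_one_le (one_le_bracket x) (one_le_bracket y)

theorem IsSmallPair.symm {k m n : ℤ} (h : IsSmallPair k m n) : IsSmallPair k n m := by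
  unfold IsSmallPair at h ⊢
  rwa [mul_comm (bracket n)]

theorem IsSmallPair.bracket_le_two_mul_abs_sub {k m n : ℤ} (h : IsSmallPair k m n) :
    bracket k ≤ 2 * |(k : ℝ) - m| := by
  unfold IsSmallPair at h
  have hx := one_le_bracket_mul_bracket m n
  have hm : |(m : ℝ)| ≤ bracket m * bracket n :=
    (abs_le_bracket _).trans (le_mul_of_one_le_right (bracket_pos _).le (one_le_bracket _))
  have hk := bracket_le_one_add_abs (k : ℝ)
  have hsub := abs_sub_abs_le_abs_sub (k : ℝ) m
  nlinarith

theorem IsSmallPair.bracket_sq_le {k m n : ℤ} (h : IsSmallPair k m n) :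
    bracket k ^ 2 ≤ 4 * |((k : ℝ) - m) * (k - n)| := by
  rw [abs_mul]
  have hmul := mul_le_mul h.bracket_le_two_mul_abs_sub h.symm.bracket_le_two_mul_abs_sub
    (bracket_pos _).le (by positivity)
  linarith

theorem IsSmallPair.bracket_sub_sub_le {k m n : ℤ} (h : IsSmallPair k m n) :
    bracket (k - m - n : ℤ) ≤ 2 * bracket k := by
  unfold IsSmallPair at h
  nlinarith [one_le_bracket_mul_bracket m n, PeriodicBourgain.bracket_sub_sub_le k m n]

theorem bracket_mul_bracket_le_of_not_isSmallPair {k m n : ℤ} (h : ¬ IsSmallPair k m n) :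
    bracket k * bracket (k - m - n : ℤ) ≤ 288 * (bracket m * bracket n) ^ 5 := by
  unfold IsSmallPair at h
  push Not at h
  have hl := bracket_sub_sub_le k m n
  have hx := one_le_bracket_mul_bracket m n
  set x := bracket m * bracket n
  calc bracket k * bracket (k - m - n : ℤ) ≤ (16 * x ^ 2) * (18 * x ^ 2) := by
        gcongr
        · exact (bracket_pos _).le
        · nlinarith
    _ = 288 * x ^ 4 := by ring
    _ ≤ 288 * x ^ 5 := by
        gcongr
        norm_num

theorem modP_sub_modP_sub_modP_sub_modM (p q₁ q₂ : ℝ × ℤ) :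
    modP p - modP q₁ - modP q₂ - modM (p - q₁ - q₂) =
      2 * (((p.2 : ℝ) - q₁.2) * (p.2 - q₂.2)) := by
  simp only [modP, modM, Prod.fst_sub, Prod.snd_sub, Int.cast_sub]
  ring

theorem two_mul_abs_resonance_le (p q₁ q₂ : ℝ × ℤ) :
    2 * |((p.2 : ℝ) - q₁.2) * (p.2 - q₂.2)| ≤
      bracket (modP p) + bracket (modP q₁) + bracket (modP q₂) +
        bracket (modM (p - q₁ - q₂)) := by
  calc 2 * |((p.2 : ℝ) - q₁.2) * (p.2 - q₂.2)|
      = |modP p - modP q₁ - modP q₂ - modM (p - q₁ - q₂)| := by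
        rw [modP_sub_modP_sub_modP_sub_modM, abs_mul 2, abs_two]
    _ ≤ |modP p| + |modP q₁| + |modP q₂| + |modM (p - q₁ - q₂)| :=
        (abs_sub _ _).trans <| add_le_add_left ((abs_sub _ _).trans <|
          add_le_add_left (abs_sub _ _) _) _
    _ ≤ _ := by gcongr <;> exact abs_le_bracket _

theorem exists_dominant_modulation (p q₁ q₂ : ℝ × ℤ) :
    |((p.2 : ℝ) - q₁.2) * (p.2 - q₂.2)| ≤ 2 * bracket (modP p) ∨
    (|((p.2 : ℝ) - q₁.2) * (p.2 - q₂.2)| ≤ 2 * bracket (modP q₁) ∧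
      bracket (modP q₂) ≤ bracket (modP q₁)) ∨
    (|((p.2 : ℝ) - q₁.2) * (p.2 - q₂.2)| ≤ 2 * bracket (modP q₂) ∧
      bracket (modP q₁) ≤ bracket (modP q₂)) ∨
    |((p.2 : ℝ) - q₁.2) * (p.2 - q₂.2)| ≤ 2 * bracket (modM (p - q₁ - q₂)) := by
  have h := two_mul_abs_resonance_le p q₁ q₂
  grind

theorem resonance_of_high {p q₁ q₂ : ℝ × ℤ}
    (h : 4 * (bracket q₁.2 * bracket q₂.2) < bracket p.2 * bracket (p - q₁ - q₂).2) :
    bracket p.2 * bracket (p - q₁ - q₂).2 ≤ 4 * |((p.2 : ℝ) - q₁.2) * (p.2 - q₂.2)| := by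
  have hres := bracket_mul_bracket_sub_sub_le p.2 q₁.2 q₂.2
  simp only [Prod.snd_sub] at h ⊢
  linarith

theorem nonresonant_of_high {p q₁ q₂ : ℝ × ℤ}
    (h : 4 * (bracket q₁.2 * bracket q₂.2) < bracket p.2 * bracket (p - q₁ - q₂).2) :
    p.2 ≠ q₁.2 ∧ p.2 ≠ q₂.2 := by
  have hpos : 0 < |((p.2 : ℝ) - q₁.2) * (p.2 - q₂.2)| := by
    linarith [resonance_of_high h, one_le_bracket_mul_bracket q₁.2 q₂.2]
  rw [abs_pos, mul_ne_zero_iff, sub_ne_zero, sub_ne_zero] at hpos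
  exact_mod_cast hpos

/-! ### The multiplier bound -/

/-- The exponential with values in `[0, ∞]`. Written with it, products of powers of brackets are
compared by comparing linear forms in the logarithms. -/
noncomputable def eexp (t : ℝ) : ℝ≥0∞ := ENNReal.ofReal (Real.exp t)

theorem eexp_mul_eexp (s t : ℝ) : eexp s * eexp t = eexp (s + t) := by
  unfold eexp
  rw [← ENNReal.ofReal_mul (Real.exp_pos s).le, Real.exp_add]

theorem eexp_le_eexp {s t : ℝ} (h : s ≤ t) : eexp s ≤ eexp t :=
  ENNReal.ofReal_le_ofReal (Real.exp_le_exp.mpr h)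

/-- The logarithm of the bracket. -/
noncomputable def logBracket (y : ℝ) : ℝ := Real.log (bracket y)

theorem logBracket_nonneg (y : ℝ) : 0 ≤ logBracket y := Real.log_nonneg (one_le_bracket y)

theorem exp_logBracket (y : ℝ) : Real.exp (logBracket y) = bracket y :=
  Real.exp_log (bracket_pos y)

theorem logBracket_le_log_add {c x y : ℝ} (hc : 0 < c) (h : bracket x ≤ c * bracket y) :
    logBracket x ≤ Real.log c + logBracket y := by
  rw [logBracket, logBracket, ← Real.log_mul hc.ne' (bracket_pos y).ne']
  exact Real.log_le_log (bracket_pos x) h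

theorem logBracket_add_le {c x y z : ℝ} (hc : 0 < c) (h : bracket x * bracket y ≤ c * bracket z) :
    logBracket x + logBracket y ≤ Real.log c + logBracket z := by
  rw [logBracket, logBracket, logBracket, ← Real.log_mul hc.ne' (bracket_pos z).ne',
    ← Real.log_mul (bracket_pos x).ne' (bracket_pos y).ne']
  exact Real.log_le_log (mul_pos (bracket_pos x) (bracket_pos y)) h

theorem logBracket_add_le_pow {c x y z w : ℝ} (hc : 0 < c) (k : ℕ)
    (h : bracket x * bracket y ≤ c * (bracket z * bracket w) ^ k) :
    logBracket x + logBracket y ≤ Real.log c + k * (logBracket z + logBracket w) := by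
  have hz := bracket_pos z
  have hw := bracket_pos w
  simp only [logBracket]
  rw [← Real.log_mul hz.ne' hw.ne', ← Real.log_pow, ← Real.log_mul hc.ne' (by positivity),
    ← Real.log_mul (bracket_pos x).ne' (bracket_pos y).ne']
  exact Real.log_le_log (mul_pos (bracket_pos x) (bracket_pos y)) h

theorem decay_eq_eexp (p y : ℝ) : decay p y = eexp (-p * logBracket y) := by
  rw [decay, eexp, logBracket, Real.rpow_def_of_pos (bracket_pos y), mul_comm]

theorem ofReal_abs_le_eexp (y : ℝ) : ENNReal.ofReal |y| ≤ eexp (logBracket y) := by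
  rw [eexp, exp_logBracket]
  exact ENNReal.ofReal_le_ofReal (abs_le_bracket y)

/-- The Cauchy–Schwarz weight adapted to outputs of modulation at least `⟨ξ⟩²`; it is square
integrable in `τ` uniformly in `ξ`. -/
noncomputable def farWeight (p : ℝ × ℤ) : ℝ≥0∞ :=
  ENNReal.ofReal (bracket p.2 / √(bracket p.2 ^ 4 + modP p ^ 2))

@[fun_prop]
theorem measurable_farWeight : Measurable farWeight := by
  have h : Measurable fun p : ℝ × ℤ => bracket p.2 :=
    continuous_bracket.measurable.comp (by fun_prop)
  unfold farWeight
  fun_prop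

theorem eexp_le_farWeight {p : ℝ × ℤ} (h : bracket p.2 ^ 2 ≤ 8 * bracket (modP p)) :
    eexp (logBracket p.2 - logBracket (modP p) - Real.log 9) ≤ farWeight p := by
  have hx := bracket_pos (p.2 : ℝ)
  have hs := bracket_pos (modP p)
  rw [eexp, farWeight, sub_sub, Real.exp_sub, Real.exp_add, exp_logBracket, exp_logBracket,
    Real.exp_log (by norm_num)]
  refine ENNReal.ofReal_le_ofReal (div_le_div_of_nonneg_left hx.le (by positivity) ?_)
  rw [Real.sqrt_le_left (by positivity)]
  nlinarith [bracket_sq (modP p), pow_le_pow_left₀ (by positivity) h 2]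

theorem exists_lintegral_farWeight_sq_le :
    ∃ C : ℝ≥0, ∀ ξ : ℤ, ∫⁻ τ : ℝ, farWeight (τ, ξ) ^ 2 ≤ C := by
  refine ⟨Real.pi.toNNReal, fun ξ => le_of_eq ?_⟩
  have hx := bracket_pos (ξ : ℝ)
  set x := bracket (ξ : ℝ) with hxdef
  let h (y : ℝ) := x⁻¹ ^ 2 * (1 + (y / x ^ 2) ^ 2)⁻¹
  have hInt : Integrable h :=
    (integrable_inv_one_add_sq.comp_div (by positivity)).const_mul _
  calc ∫⁻ τ : ℝ, farWeight (τ, ξ) ^ 2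
      = ∫⁻ τ : ℝ, ENNReal.ofReal (h (τ + (ξ : ℝ) ^ 2)) := by
        refine lintegral_congr fun τ => ?_
        simp only [farWeight, modP, ← hxdef, h]
        rw [← ENNReal.ofReal_pow (by positivity), div_pow, Real.sq_sqrt (by positivity)]
        congr 1
        field_simp
    _ = ∫⁻ τ : ℝ, ENNReal.ofReal (h τ) :=
        lintegral_add_right_eq_self (fun y => ENNReal.ofReal (h y)) _
    _ = ENNReal.ofReal (∫ τ : ℝ, h τ) :=
        (ofReal_integral_eq_lintegral_ofReal hInt (.of_forall fun y => by positivity)).symm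
    _ = ENNReal.ofReal Real.pi := by
        rw [integral_const_mul, Measure.integral_comp_div (fun y : ℝ => (1 + y ^ 2)⁻¹) (x ^ 2),
          integral_univ_inv_one_add_sq, abs_of_pos (by positivity), smul_eq_mul, ← mul_assoc,
          ← mul_pow, inv_mul_cancel₀ hx.ne', one_pow, one_mul]

/-- The weight of the `X_{1/2,b}`-norm. -/
noncomputable def wP (b : ℝ) (q : ℝ × ℤ) : ℝ≥0∞ := decay (-(1 / 2)) q.2 * decay (-b) (modP q)

/-- The weight of the `X^-_{1/2,b}`-norm. -/
noncomputable def wM (b : ℝ) (q : ℝ × ℤ) : ℝ≥0∞ := decay (-(1 / 2)) q.2 * decay (-b) (modM q)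

@[fun_prop]
theorem measurable_wP (b : ℝ) : Measurable (wP b) := by
  unfold wP
  fun_prop

@[fun_prop]
theorem measurable_wM (b : ℝ) : Measurable (wM b) := by
  unfold wM
  fun_prop

/-- The product of the weights of the three input norms at the frequencies `q₁`, `q₂` and
`q₃ = p - q₁ - q₂`. -/
noncomputable def inputWeight (b₁ b₂ b₃ : ℝ) (p q₁ q₂ : ℝ × ℤ) : ℝ≥0∞ :=
  wP b₁ q₁ * wP b₂ q₂ * wM b₃ (p - q₁ - q₂)

theorem inputWeight_swap (b₁ b₂ b₃ : ℝ) (p q₁ q₂ : ℝ × ℤ) :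
    inputWeight b₁ b₂ b₃ p q₁ q₂ = inputWeight b₂ b₁ b₃ p q₂ q₁ := by
  rw [inputWeight, inputWeight, sub_right_comm, mul_comm (wP b₁ q₁)]

/-- The Fourier multiplier of the estimate: the weight of the `Y_{1/2,-1}`-norm at the output times
the symbol of the derivative on the third factor. -/
noncomputable def multiplier (p q₁ q₂ : ℝ × ℤ) : ℝ≥0∞ :=
  decay 1 (modP p) * decay (-(1 / 2)) p.2 * ENNReal.ofReal |((p - q₁ - q₂).2 : ℝ)|

theorem multiplier_swap (p q₁ q₂ : ℝ × ℤ) : multiplier p q₁ q₂ = multiplier p q₂ q₁ := by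
  rw [multiplier, multiplier, sub_right_comm]

theorem multiplier_le_mul_eexp {p q₁ q₂ : ℝ × ℤ} {t : ℝ}
    (h : -logBracket (modP p) + 1 / 2 * logBracket p.2 + logBracket (p - q₁ - q₂).2 ≤
      Real.log 288 + t) :
    multiplier p q₁ q₂ ≤ 288 * eexp t := by
  calc multiplier p q₁ q₂
      ≤ decay 1 (modP p) * decay (-(1 / 2)) p.2 * eexp (logBracket (p - q₁ - q₂).2) := by
        unfold multiplier
        gcongr
        exact ofReal_abs_le_eexp _
    _ = eexp (-logBracket (modP p) + 1 / 2 * logBracket p.2 + logBracket (p - q₁ - q₂).2) := by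
        rw [decay_eq_eexp, decay_eq_eexp, eexp_mul_eexp, eexp_mul_eexp]
        ring_nf
    _ ≤ eexp (Real.log 288 + t) := eexp_le_eexp h
    _ = 288 * eexp t := by
        rw [← eexp_mul_eexp, eexp, Real.exp_log (by norm_num), ENNReal.ofReal_ofNat]

theorem multiplier_le_kerLow {p q₁ q₂ : ℝ × ℤ}
    (h : bracket p.2 * bracket (p - q₁ - q₂).2 ≤ 4 * (bracket q₁.2 * bracket q₂.2)) :
    multiplier p q₁ q₂ ≤ 288 * (decay (33 / 64) (modP p) *
      (kerLow p q₁ q₂ * inputWeight (1 / 2) (31 / 64) (31 / 64) p q₁ q₂)) := by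
  have hlog := logBracket_add_le_pow (c := 4) (by norm_num) 1 (by simpa only [pow_one] using h)
  have hconst : Real.log 4 ≤ Real.log 288 := Real.log_le_log (by norm_num) (by norm_num)
  have hfour : 0 ≤ Real.log 4 := Real.log_nonneg (by norm_num)
  simp only [kerLow, outThird, inputWeight, wP, wM, decay_eq_eexp, eexp_mul_eexp]
  refine multiplier_le_mul_eexp ?_
  push_cast at hlog
  linarith [logBracket_nonneg (modP q₁)]

theorem logBracket_add_le_of_high {p q₁ q₂ : ℝ × ℤ} {y : ℝ}
    (hhigh : 4 * (bracket q₁.2 * bracket q₂.2) < bracket p.2 * bracket (p - q₁ - q₂).2)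
    (h : |((p.2 : ℝ) - q₁.2) * (p.2 - q₂.2)| ≤ 2 * bracket y) :
    logBracket p.2 + logBracket (p - q₁ - q₂).2 ≤ Real.log 288 + logBracket y :=
  logBracket_add_le (by norm_num) (by linarith [resonance_of_high hhigh, bracket_pos y])

theorem logBracket_add_le_of_not_isSmallPair {p q₁ q₂ : ℝ × ℤ}
    (h : ¬ IsSmallPair p.2 q₁.2 q₂.2) :
    logBracket p.2 + logBracket (p - q₁ - q₂).2 ≤
      Real.log 288 + (5 : ℕ) * (logBracket q₁.2 + logBracket q₂.2) :=
  logBracket_add_le_pow (by norm_num) 5 (bracket_mul_bracket_le_of_not_isSmallPair h)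

theorem multiplier_le_farWeight {p q₁ q₂ : ℝ × ℤ}
    (hhigh : 4 * (bracket q₁.2 * bracket q₂.2) < bracket p.2 * bracket (p - q₁ - q₂).2)
    (h : |((p.2 : ℝ) - q₁.2) * (p.2 - q₂.2)| ≤ 2 * bracket (modP p))
    (hS : IsSmallPair p.2 q₁.2 q₂.2) :
    multiplier p q₁ q₂ ≤ 288 * (farWeight p *
      (kerOut p q₁ q₂ * inputWeight (1 / 2) (31 / 64) (31 / 64) p q₁ q₂)) := by
  have hthird : logBracket (p - q₁ - q₂).2 ≤ Real.log 2 + logBracket p.2 :=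
    logBracket_le_log_add (by norm_num) hS.bracket_sub_sub_le
  have hconst : Real.log 288 = Real.log 9 + 5 * Real.log 2 := by
    rw [show (288 : ℝ) = 9 * 2 ^ 5 by norm_num, Real.log_mul (by norm_num) (by norm_num),
      Real.log_pow]
    norm_num
  have htwo : 0 ≤ Real.log 2 := Real.log_nonneg (by norm_num)
  refine le_trans ?_ (mul_le_mul_right (mul_le_mul_left
    (eexp_le_farWeight (by linarith [hS.bracket_sq_le])) _) _)
  simp only [kerOut, nonresonantWeight, if_pos (nonresonant_of_high hhigh), inputWeight, wP, wM,
    decay_eq_eexp, eexp_mul_eexp]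
  refine multiplier_le_mul_eexp ?_
  linarith [logBracket_nonneg q₁.2, logBracket_nonneg q₂.2, logBracket_nonneg (modP q₁)]

theorem multiplier_le_kerOut {p q₁ q₂ : ℝ × ℤ}
    (hhigh : 4 * (bracket q₁.2 * bracket q₂.2) < bracket p.2 * bracket (p - q₁ - q₂).2)
    (h : |((p.2 : ℝ) - q₁.2) * (p.2 - q₂.2)| ≤ 2 * bracket (modP p))
    (hS : ¬ IsSmallPair p.2 q₁.2 q₂.2) :
    multiplier p q₁ q₂ ≤ 288 * (decay (33 / 64) (modP p) *
      (kerOut p q₁ q₂ * inputWeight (1 / 2) (31 / 64) (31 / 64) p q₁ q₂)) := by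
  have hmod := logBracket_add_le_of_high hhigh h
  have hfreq := logBracket_add_le_of_not_isSmallPair hS
  simp only [kerOut, nonresonantWeight, if_pos (nonresonant_of_high hhigh), inputWeight, wP, wM,
    decay_eq_eexp, eexp_mul_eexp]
  refine multiplier_le_mul_eexp ?_
  push_cast at hfreq
  linarith [logBracket_nonneg (modP q₁), Real.log_nonneg (x := 288) (by norm_num)]

theorem multiplier_le_kerSmall {p q₁ q₂ : ℝ × ℤ}
    (hhigh : 4 * (bracket q₁.2 * bracket q₂.2) < bracket p.2 * bracket (p - q₁ - q₂).2)
    (h : |((p.2 : ℝ) - q₁.2) * (p.2 - q₂.2)| ≤ 2 * bracket (modP q₁))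
    (hS : IsSmallPair p.2 q₁.2 q₂.2) :
    multiplier p q₁ q₂ ≤ 288 * (decay (33 / 64) (modP p) *
      (kerSmall p q₁ q₂ * inputWeight (1 / 2) (31 / 64) (31 / 64) p q₁ q₂)) := by
  have hmod := logBracket_add_le_of_high hhigh h
  simp only [kerSmall, smallPairWeight, if_pos hS, inputWeight, wP, wM, decay_eq_eexp,
    eexp_mul_eexp]
  refine multiplier_le_mul_eexp ?_
  linarith [logBracket_nonneg q₁.2, Real.log_nonneg (x := 288) (by norm_num)]

theorem multiplier_le_kerFirst {p q₁ q₂ : ℝ × ℤ}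
    (hhigh : 4 * (bracket q₁.2 * bracket q₂.2) < bracket p.2 * bracket (p - q₁ - q₂).2)
    (h : |((p.2 : ℝ) - q₁.2) * (p.2 - q₂.2)| ≤ 2 * bracket (modP q₁))
    (hle : bracket (modP q₂) ≤ bracket (modP q₁)) (hS : ¬ IsSmallPair p.2 q₁.2 q₂.2) :
    multiplier p q₁ q₂ ≤ 288 * (decay (33 / 64) (modP p) *
      (kerFirst p q₁ q₂ * inputWeight (1 / 2) (31 / 64) (31 / 64) p q₁ q₂)) := by
  have hmod := logBracket_add_le_of_high hhigh h
  have hfreq := logBracket_add_le_of_not_isSmallPair hS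
  have hlog : logBracket (modP q₂) ≤ logBracket (modP q₁) := Real.log_le_log (bracket_pos _) hle
  simp only [kerFirst, outThird, inputWeight, wP, wM, decay_eq_eexp, eexp_mul_eexp]
  refine multiplier_le_mul_eexp ?_
  push_cast at hfreq
  linarith [Real.log_nonneg (x := 288) (by norm_num)]

theorem multiplier_le_kerThird {p q₁ q₂ : ℝ × ℤ}
    (hhigh : 4 * (bracket q₁.2 * bracket q₂.2) < bracket p.2 * bracket (p - q₁ - q₂).2)
    (h : |((p.2 : ℝ) - q₁.2) * (p.2 - q₂.2)| ≤ 2 * bracket (modM (p - q₁ - q₂))) :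
    multiplier p q₁ q₂ ≤ 288 * (decay (33 / 64) (modP p) *
      (kerThird p q₁ q₂ * inputWeight (31 / 64) (31 / 64) (1 / 2) p q₁ q₂)) := by
  have hmod := logBracket_add_le_of_high hhigh h
  simp only [kerThird, nonresonantWeight, if_pos (nonresonant_of_high hhigh), inputWeight, wP, wM,
    decay_eq_eexp, eexp_mul_eexp]
  refine multiplier_le_mul_eexp ?_
  linarith [logBracket_nonneg q₁.2, logBracket_nonneg q₂.2,
    Real.log_nonneg (x := 288) (by norm_num)]

/-- The sum of the kernels of all the ranges in which the first input is measured in full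
strength. -/
noncomputable def kerMain (p q₁ q₂ : ℝ × ℤ) : ℝ≥0∞ :=
  kerLow p q₁ q₂ + kerOut p q₁ q₂ + kerFirst p q₁ q₂ + kerSmall p q₁ q₂

theorem multiplier_le_kerMain_of_first_dominant {p q₁ q₂ : ℝ × ℤ}
    (hhigh : 4 * (bracket q₁.2 * bracket q₂.2) < bracket p.2 * bracket (p - q₁ - q₂).2)
    (h : |((p.2 : ℝ) - q₁.2) * (p.2 - q₂.2)| ≤ 2 * bracket (modP q₁))
    (hle : bracket (modP q₂) ≤ bracket (modP q₁)) :
    multiplier p q₁ q₂ ≤ 288 * (decay (33 / 64) (modP p) *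
      (kerMain p q₁ q₂ * inputWeight (1 / 2) (31 / 64) (31 / 64) p q₁ q₂)) := by
  by_cases hS : IsSmallPair p.2 q₁.2 q₂.2
  · refine (multiplier_le_kerSmall hhigh h hS).trans ?_
    gcongr
    exact le_add_self
  · refine (multiplier_le_kerFirst hhigh h hle hS).trans ?_
    gcongr
    exact le_add_self.trans le_self_add

theorem multiplier_le_of_output_dominant {p q₁ q₂ : ℝ × ℤ}
    (hhigh : 4 * (bracket q₁.2 * bracket q₂.2) < bracket p.2 * bracket (p - q₁ - q₂).2)
    (h : |((p.2 : ℝ) - q₁.2) * (p.2 - q₂.2)| ≤ 2 * bracket (modP p)) :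
    multiplier p q₁ q₂ ≤ 288 * ((decay (33 / 64) (modP p) * kerMain p q₁ q₂ +
      farWeight p * kerOut p q₁ q₂) * inputWeight (1 / 2) (31 / 64) (31 / 64) p q₁ q₂) := by
  rw [add_mul, mul_assoc, mul_assoc]
  by_cases hS : IsSmallPair p.2 q₁.2 q₂.2
  · refine (multiplier_le_farWeight hhigh h hS).trans ?_
    gcongr
    exact le_add_self
  · refine (multiplier_le_kerOut hhigh h hS).trans ?_
    gcongr
    refine le_trans ?_ le_self_add
    gcongr
    exact (le_add_self.trans le_self_add).trans le_self_add

theorem multiplier_le (p q₁ q₂ : ℝ × ℤ) :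
    multiplier p q₁ q₂ ≤ 288 * (
      decay (33 / 64) (modP p) *
        (kerMain p q₁ q₂ * inputWeight (1 / 2) (31 / 64) (31 / 64) p q₁ q₂) +
      farWeight p * (kerOut p q₁ q₂ * inputWeight (1 / 2) (31 / 64) (31 / 64) p q₁ q₂) +
      decay (33 / 64) (modP p) *
        (kerMain p q₂ q₁ * inputWeight (31 / 64) (1 / 2) (31 / 64) p q₁ q₂) +
      decay (33 / 64) (modP p) *
        (kerThird p q₁ q₂ * inputWeight (31 / 64) (31 / 64) (1 / 2) p q₁ q₂)) := by
  rcases le_or_gt (bracket p.2 * bracket (p - q₁ - q₂).2) (4 * (bracket q₁.2 * bracket q₂.2))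
    with hlow | hhigh
  · refine (multiplier_le_kerLow hlow).trans ?_
    gcongr 288 * ?_
    refine le_trans ?_ ((le_self_add.trans le_self_add).trans le_self_add)
    gcongr
    exact (le_self_add.trans le_self_add).trans le_self_add
  rcases exists_dominant_modulation p q₁ q₂ with h | ⟨h, hle⟩ | ⟨h, hle⟩ | h
  · refine (multiplier_le_of_output_dominant hhigh h).trans ?_
    rw [add_mul, mul_assoc, mul_assoc]
    gcongr 288 * ?_
    exact le_self_add.trans le_self_add
  · refine (multiplier_le_kerMain_of_first_dominant hhigh h hle).trans ?_
    gcongr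
    exact (le_self_add.trans le_self_add).trans le_self_add
  · rw [mul_comm (bracket q₁.2), sub_right_comm] at hhigh
    rw [mul_comm] at h
    rw [multiplier_swap, inputWeight_swap (31 / 64) (1 / 2)]
    refine (multiplier_le_kerMain_of_first_dominant hhigh h hle).trans ?_
    gcongr
    exact le_add_self.trans le_self_add
  · refine (multiplier_le_kerThird hhigh h).trans ?_
    gcongr
    exact le_add_self

/-! ### The trilinear estimate -/

theorem isL2Kernel_kerMain : IsL2Kernel freqMeasure kerMain :=
  ((isL2Kernel_kerLow.add isL2Kernel_kerOut).add isL2Kernel_kerFirst).add isL2Kernel_kerSmall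

/-- The square of the norm of `ℓ²_ξ L¹_τ`, the space underlying `Y_{s,b}`. -/
noncomputable def mixedNormSq (g : ℝ × ℤ → ℝ≥0∞) : ℝ≥0∞ :=
  ∑' ξ : ℤ, (∫⁻ τ : ℝ, g (τ, ξ)) ^ 2

theorem mixedNormSq_mono {g h : ℝ × ℤ → ℝ≥0∞} (hgh : ∀ p, g p ≤ h p) :
    mixedNormSq g ≤ mixedNormSq h :=
  ENNReal.tsum_le_tsum fun ξ => pow_le_pow_left₀ zero_le (lintegral_mono fun τ => hgh (τ, ξ)) 2

theorem mixedNormSq_const_mul (c : ℝ≥0) (g : ℝ × ℤ → ℝ≥0∞) :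
    mixedNormSq (fun p => c * g p) = c ^ 2 * mixedNormSq g := by
  simp only [mixedNormSq, lintegral_const_mul' _ _ ENNReal.coe_ne_top, mul_pow,
    ENNReal.tsum_mul_left]

theorem mixedNormSq_add_le {g h : ℝ × ℤ → ℝ≥0∞} (hg : Measurable g) :
    mixedNormSq (fun p => g p + h p) ≤ 2 * (mixedNormSq g + mixedNormSq h) := by
  simp only [mixedNormSq, ← ENNReal.tsum_add, ← ENNReal.tsum_mul_left]
  refine ENNReal.tsum_le_tsum fun ξ => ?_
  rw [lintegral_add_left (f := fun τ => g (τ, ξ)) (hg.comp measurable_prodMk_right)]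
  exact add_sq_le_two_mul _ _

theorem mixedNormSq_mul_le {a g : ℝ × ℤ → ℝ≥0∞} (ha : Measurable a) (hg : Measurable g) {C : ℝ≥0}
    (hC : ∀ ξ : ℤ, ∫⁻ τ : ℝ, a (τ, ξ) ^ 2 ≤ C) :
    mixedNormSq (fun p => a p * g p) ≤ C * ∫⁻ p, g p ^ 2 ∂freqMeasure := by
  rw [lintegral_freqMeasure (hg.pow_const 2), ← ENNReal.tsum_mul_left]
  refine ENNReal.tsum_le_tsum fun ξ => ?_
  refine (lintegral_mul_sq_le ?_ ?_).trans (mul_le_mul_left (hC ξ) _)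
  · exact ha.comp measurable_prodMk_right
  · exact hg.comp measurable_prodMk_right

/-- The product of the squares of the weighted `L²`-norms of the three inputs. -/
noncomputable def normProd (b₁ b₂ b₃ : ℝ) (F₁ F₂ F₃ : ℝ × ℤ → ℝ≥0∞) : ℝ≥0∞ :=
  (∫⁻ q, (wP b₁ q * F₁ q) ^ 2 ∂freqMeasure) * (∫⁻ q, (wP b₂ q * F₂ q) ^ 2 ∂freqMeasure) *
    ∫⁻ q, (wM b₃ q * F₃ q) ^ 2 ∂freqMeasure

/-- The right-hand side of the trilinear estimate. In each term two of the inputs carry a weakened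
weight, which leaves room for a gain in `T`; the other one is the input of dominant modulation. -/
noncomputable def energy (F₁ F₂ F₃ : ℝ × ℤ → ℝ≥0∞) : ℝ≥0∞ :=
  normProd (1 / 2) (31 / 64) (31 / 64) F₁ F₂ F₃ + normProd (31 / 64) (1 / 2) (31 / 64) F₁ F₂ F₃ +
    normProd (31 / 64) (31 / 64) (1 / 2) F₁ F₂ F₃

/-- The measurable kernels whose trilinear convolution is bounded, as a map to `ℓ²_ξ L¹_τ`, by the
energy. -/
structure IsEnergyKernel (K : ℝ × ℤ → ℝ × ℤ → ℝ × ℤ → ℝ≥0∞) : Prop where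
  measurable : Measurable fun z : (ℝ × ℤ) × (ℝ × ℤ) × (ℝ × ℤ) => K z.1 z.2.1 z.2.2
  bound : ∃ C : ℝ≥0, ∀ F₁ F₂ F₃ : ℝ × ℤ → ℝ≥0∞, Measurable F₁ → Measurable F₂ → Measurable F₃ →
    mixedNormSq (trilin freqMeasure K F₁ F₂ F₃) ≤ C * energy F₁ F₂ F₃

theorem IsEnergyKernel.add {K L : ℝ × ℤ → ℝ × ℤ → ℝ × ℤ → ℝ≥0∞}
    (hK : IsEnergyKernel K) (hL : IsEnergyKernel L) :
    IsEnergyKernel fun p q₁ q₂ => K p q₁ q₂ + L p q₁ q₂ where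
  measurable := hK.measurable.add hL.measurable
  bound := by
    obtain ⟨C, hC⟩ := hK.bound
    obtain ⟨D, hD⟩ := hL.bound
    refine ⟨2 * (C + D), fun F₁ F₂ F₃ h₁ h₂ h₃ => ?_⟩
    calc mixedNormSq (trilin freqMeasure (fun p q₁ q₂ => K p q₁ q₂ + L p q₁ q₂) F₁ F₂ F₃)
        ≤ 2 * (mixedNormSq (trilin freqMeasure K F₁ F₂ F₃) +
            mixedNormSq (trilin freqMeasure L F₁ F₂ F₃)) := by
          rw [funext (trilin_add hK.measurable h₁ h₂ h₃)]
          exact mixedNormSq_add_le (measurable_trilin hK.measurable h₁ h₂ h₃)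
      _ ≤ 2 * (C * energy F₁ F₂ F₃ + D * energy F₁ F₂ F₃) := by
          gcongr
          exacts [hC _ _ _ h₁ h₂ h₃, hD _ _ _ h₁ h₂ h₃]
      _ = _ := by
          push_cast
          ring

theorem trilin_mul_inputWeight {a : ℝ × ℤ → ℝ≥0∞} {K : ℝ × ℤ → ℝ × ℤ → ℝ × ℤ → ℝ≥0∞}
    (hK : Measurable fun z : (ℝ × ℤ) × (ℝ × ℤ) × (ℝ × ℤ) => K z.1 z.2.1 z.2.2) (b₁ b₂ b₃ : ℝ)
    {F₁ F₂ F₃ : ℝ × ℤ → ℝ≥0∞} (h₁ : Measurable F₁) (h₂ : Measurable F₂) (h₃ : Measurable F₃)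
    (p : ℝ × ℤ) :
    trilin freqMeasure (fun p q₁ q₂ => a p * (K p q₁ q₂ * inputWeight b₁ b₂ b₃ p q₁ q₂))
        F₁ F₂ F₃ p =
      a p * trilin freqMeasure K (fun q => wP b₁ q * F₁ q) (fun q => wP b₂ q * F₂ q)
        (fun q => wM b₃ q * F₃ q) p := by
  rw [trilin, trilin, ← lintegral_const_mul]
  · refine lintegral_congr fun q => ?_
    rw [inputWeight]
    ring
  · exact (measurable_trilin_integrand (f₁ := fun q => wP b₁ q * F₁ q)
      (f₂ := fun q => wP b₂ q * F₂ q) (f₃ := fun q => wM b₃ q * F₃ q) hK (by fun_prop)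
      (by fun_prop) (by fun_prop)).comp measurable_prodMk_left

theorem IsL2Kernel.isEnergyKernel {a : ℝ × ℤ → ℝ≥0∞} {K : ℝ × ℤ → ℝ × ℤ → ℝ × ℤ → ℝ≥0∞}
    {b₁ b₂ b₃ : ℝ} (hK : IsL2Kernel freqMeasure K) (ha : Measurable a)
    (hC : ∃ C : ℝ≥0, ∀ ξ : ℤ, ∫⁻ τ : ℝ, a (τ, ξ) ^ 2 ≤ C)
    (hb : ∀ F₁ F₂ F₃, normProd b₁ b₂ b₃ F₁ F₂ F₃ ≤ energy F₁ F₂ F₃) :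
    IsEnergyKernel fun p q₁ q₂ => a p * (K p q₁ q₂ * inputWeight b₁ b₂ b₃ p q₁ q₂) where
  measurable := by
    have hw : Measurable fun z : (ℝ × ℤ) × (ℝ × ℤ) × (ℝ × ℤ) =>
        inputWeight b₁ b₂ b₃ z.1 z.2.1 z.2.2 := by
      unfold inputWeight
      fun_prop
    exact (ha.comp measurable_fst).mul (hK.measurable.mul hw)
  bound := by
    obtain ⟨C, hC⟩ := hC
    obtain ⟨D, hD⟩ := hK.bound
    refine ⟨C * D, fun F₁ F₂ F₃ h₁ h₂ h₃ => ?_⟩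
    set G₁ := fun q => wP b₁ q * F₁ q
    set G₂ := fun q => wP b₂ q * F₂ q
    set G₃ := fun q => wM b₃ q * F₃ q
    have m₁ : Measurable G₁ := (measurable_wP b₁).mul h₁
    have m₂ : Measurable G₂ := (measurable_wP b₂).mul h₂
    have m₃ : Measurable G₃ := (measurable_wM b₃).mul h₃
    calc _ = mixedNormSq (fun p => a p * trilin freqMeasure K G₁ G₂ G₃ p) :=
          congrArg mixedNormSq
            (funext (trilin_mul_inputWeight hK.measurable b₁ b₂ b₃ h₁ h₂ h₃))
      _ ≤ C * ∫⁻ p, trilin freqMeasure K G₁ G₂ G₃ p ^ 2 ∂freqMeasure :=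
          mixedNormSq_mul_le ha (measurable_trilin hK.measurable m₁ m₂ m₃) hC
      _ ≤ C * (D * normProd b₁ b₂ b₃ F₁ F₂ F₃) := by
          gcongr
          exact hD _ _ _ m₁ m₂ m₃
      _ ≤ C * (D * energy F₁ F₂ F₃) := by
          gcongr
          exact hb _ _ _
      _ = _ := by
          push_cast
          ring

theorem exists_lintegral_decay_modP_sq_le {p : ℝ} (hp : 1 / 2 < p) :
    ∃ C : ℝ≥0, ∀ ξ : ℤ, ∫⁻ τ : ℝ, decay p (modP (τ, ξ)) ^ 2 ≤ C := by
  obtain ⟨C, hC⟩ := exists_lintegral_decay_le (p := 2 * p) (by linarith)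
  refine ⟨C, fun ξ => ?_⟩
  simpa only [decay_sq, modP, sub_neg_eq_add] using hC (-(ξ : ℝ) ^ 2)

theorem exists_trilinear_estimate :
    ∃ C : ℝ≥0, ∀ F₁ F₂ F₃ : ℝ × ℤ → ℝ≥0∞, Measurable F₁ → Measurable F₂ → Measurable F₃ →
      mixedNormSq (trilin freqMeasure multiplier F₁ F₂ F₃) ≤ C * energy F₁ F₂ F₃ := by
  have hnear : ∃ C : ℝ≥0, ∀ ξ : ℤ, ∫⁻ τ : ℝ, decay (33 / 64) (modP (τ, ξ)) ^ 2 ≤ C :=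
    exists_lintegral_decay_modP_sq_le (by norm_num)
  have mnear : Measurable fun p => decay (33 / 64) (modP p) := by fun_prop
  have hb₁ F₁ F₂ F₃ : normProd (1 / 2) (31 / 64) (31 / 64) F₁ F₂ F₃ ≤ energy F₁ F₂ F₃ :=
    le_self_add.trans le_self_add
  have hb₂ F₁ F₂ F₃ : normProd (31 / 64) (1 / 2) (31 / 64) F₁ F₂ F₃ ≤ energy F₁ F₂ F₃ :=
    le_add_self.trans le_self_add
  have hb₃ F₁ F₂ F₃ : normProd (31 / 64) (31 / 64) (1 / 2) F₁ F₂ F₃ ≤ energy F₁ F₂ F₃ :=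
    le_add_self
  have hsum := (((isL2Kernel_kerMain.isEnergyKernel mnear hnear hb₁).add
    (isL2Kernel_kerOut.isEnergyKernel measurable_farWeight exists_lintegral_farWeight_sq_le
      hb₁)).add (isL2Kernel_kerMain.swap.isEnergyKernel mnear hnear hb₂)).add
    (isL2Kernel_kerThird.isEnergyKernel mnear hnear hb₃)
  obtain ⟨C, hC⟩ := hsum.bound
  refine ⟨288 ^ 2 * C, fun F₁ F₂ F₃ h₁ h₂ h₃ => ?_⟩
  have hle := mixedNormSq_mono
    (trilin_le_mul_trilin (c := 288) (μ := freqMeasure) (f₁ := F₁) (f₂ := F₂) (f₃ := F₃)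
      multiplier_le)
  rw [mixedNormSq_const_mul] at hle
  refine hle.trans ((mul_le_mul_right (hC F₁ F₂ F₃ h₁ h₂ h₃) _).trans_eq ?_)
  push_cast
  ring

open scoped ContDiff FourierTransform SchwartzMap

/-! ### Fourier series in space -/

/-- The normalizing constant `(2π)^{-1/2}` of both Fourier transforms. -/
noncomputable def normConst : ℝ := (2 * Real.pi) ^ (-(1 / 2) : ℝ)

theorem normConst_pos : 0 < normConst := Real.rpow_pos_of_pos (by positivity) _

theorem normConst_mul_self : normConst * normConst = (2 * Real.pi)⁻¹ := by
  rw [normConst, ← Real.rpow_add (by positivity), ← Real.rpow_neg_one]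
  norm_num

theorem normConst_le_one : normConst ≤ 1 :=
  Real.rpow_le_one_of_one_le_of_nonpos (by linarith [Real.pi_gt_three]) (by norm_num)

theorem norm_normConst : ‖(normConst : ℂ)‖ = normConst := by
  rw [Complex.norm_real, Real.norm_of_nonneg normConst_pos.le]

theorem norm_normConst_mul_le (z : ℂ) : ‖normConst * z‖ ≤ ‖z‖ := by
  rw [norm_mul, norm_normConst]
  exact mul_le_of_le_one_left (norm_nonneg z) normConst_le_one

theorem enorm_normConst_mul_le (z : ℂ) : ‖normConst * z‖ₑ ≤ ‖z‖ₑ :=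
  enorm_le_iff_norm_le.mpr (norm_normConst_mul_le z)

theorem fourierX_eq (g : ℝ → ℂ) (ξ : ℤ) : fourierX g ξ =
    normConst * ∫ x in (0 : ℝ)..(2 * Real.pi), Complex.exp (-(Complex.I * x * ξ)) * g x := rfl

theorem norm_fourierX_le {g : ℝ → ℂ} {C : ℝ} (hg : ∀ x ∈ Set.Ioc 0 (2 * Real.pi), ‖g x‖ ≤ C)
    (ξ : ℤ) : ‖fourierX g ξ‖ ≤ C * (2 * Real.pi) := by
  have h2π : (0 : ℝ) ≤ 2 * Real.pi := by positivity
  refine (norm_normConst_mul_le _).trans ?_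
  refine (intervalIntegral.norm_integral_le_of_norm_le_const (C := C) fun x hx => ?_).trans_eq
    (by rw [sub_zero, abs_of_nonneg h2π])
  rw [Set.uIoc_of_le h2π] at hx
  simpa [Complex.norm_exp] using hg x hx

theorem fourierX_deriv {g g' : ℝ → ℂ} (hg : ∀ x, HasDerivAt g (g' x) x) (hg' : Continuous g')
    (hper : g (2 * Real.pi) = g 0) (ξ : ℤ) :
    fourierX g' ξ = Complex.I * ξ * fourierX g ξ := by
  have hexp (x : ℝ) : HasDerivAt (fun x : ℝ => Complex.exp (-(Complex.I * x * ξ)))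
      (-(Complex.I * ξ) * Complex.exp (-(Complex.I * x * ξ))) x := by
    have hlin : HasDerivAt (fun x : ℝ => -(Complex.I * x * ξ)) (-(Complex.I * 1 * ξ)) x :=
      (((Complex.ofRealCLM.hasDerivAt (x := x)).const_mul Complex.I).mul_const (ξ : ℂ)).neg
    convert hlin.cexp using 1
    ring
  have hend : Complex.exp (-(Complex.I * (2 * Real.pi : ℝ) * ξ)) = 1 := by
    rw [← Complex.exp_int_mul_two_pi_mul_I (-ξ)]
    push_cast
    ring_nf
  have hparts := intervalIntegral.integral_mul_deriv_eq_deriv_mul (a := 0) (b := 2 * Real.pi)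
    (fun x _ => hexp x) (fun x _ => hg x)
    (by apply Continuous.intervalIntegrable; fun_prop) (hg'.intervalIntegrable _ _)
  rw [fourierX_eq, hparts, hend, hper, fourierX_eq]
  simp only [mul_assoc (-(Complex.I * (ξ : ℂ))), intervalIntegral.integral_const_mul,
    Complex.ofReal_zero, mul_zero, zero_mul, neg_zero, Complex.exp_zero]
  ring

theorem hasSum_fourierX {g : ℝ → ℂ} (hg : Continuous g) (hper : g.Periodic (2 * Real.pi))
    (hsum : Summable (fourierX g)) (x : ℝ) :
    HasSum (fun m : ℤ => normConst * fourierX g m * Complex.exp (Complex.I * x * m)) (g x) := by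
  have : Fact (0 < 2 * Real.pi) := ⟨by positivity⟩
  have hpi : (Real.pi : ℂ) ≠ 0 := by exact_mod_cast Real.pi_ne_zero
  let f : C(AddCircle (2 * Real.pi), ℂ) := ⟨hper.lift, continuous_coinduced_dom.mpr hg⟩
  have hf (y : ℝ) : f (y : AddCircle (2 * Real.pi)) = g y := hper.lift_coe y
  have hcoeff (m : ℤ) : fourierCoeff f m = normConst * fourierX g m := by
    rw [fourierCoeff_eq_intervalIntegral f m 0, fourierX_eq, ← mul_assoc, ← Complex.ofReal_mul,
      normConst_mul_self, zero_add, Complex.real_smul, one_div]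
    congr 1
    refine intervalIntegral.integral_congr fun y _ => ?_
    simp only [hf, fourier_coe_apply, smul_eq_mul]
    congr 2
    push_cast
    field_simp
  have hseries := has_pointwise_sum_fourier_series_of_summable (f := f)
    ((hsum.mul_left (normConst : ℂ)).congr fun m => (hcoeff m).symm) x
  rw [hf] at hseries
  refine hseries.congr_fun fun m => ?_
  rw [hcoeff, fourier_coe_apply, smul_eq_mul]
  congr 2
  push_cast
  field_simp

theorem hasSum_fourierX_mul {g h : ℝ → ℂ} (hg : Continuous g) (hper : g.Periodic (2 * Real.pi))
    (hsum : Summable (fourierX g)) (hh : Continuous h) (ξ : ℤ) :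
    HasSum (fun m : ℤ => normConst * (fourierX g m * fourierX h (ξ - m)))
      (fourierX (fun x => g x * h x) ξ) := by
  have hseries (x : ℝ) : HasSum (fun m : ℤ => normConst * fourierX g m *
      (Complex.exp (-(Complex.I * x * (ξ - m : ℤ))) * h x))
      (Complex.exp (-(Complex.I * x * ξ)) * (g x * h x)) := by
    have hx := (hasSum_fourierX hg hper hsum x).mul_left (Complex.exp (-(Complex.I * x * ξ)))
    rw [← mul_assoc]
    refine (hx.mul_right (h x)).congr_fun fun m => ?_
    have hexp : Complex.exp (-(Complex.I * x * (ξ - m : ℤ))) =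
        Complex.exp (-(Complex.I * x * ξ)) * Complex.exp (Complex.I * x * m) := by
      rw [← Complex.exp_add]
      push_cast
      ring_nf
    rw [hexp]
    ring
  have hint := intervalIntegral.hasSum_integral_of_dominated_convergence (μ := volume)
    (a := 0) (b := 2 * Real.pi) (fun m x => ‖fourierX g m‖ * ‖h x‖)
    (fun m => by apply Continuous.aestronglyMeasurable; fun_prop)
    (fun m => .of_forall fun x _ => by
      rw [norm_mul, norm_mul (Complex.exp _)]
      simpa [Complex.norm_exp] using
        mul_le_mul_of_nonneg_right (norm_normConst_mul_le (fourierX g m)) (norm_nonneg (h x)))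
    (.of_forall fun x _ => hsum.norm.mul_right _)
    (by
      simp_rw [tsum_mul_right]
      exact (continuous_const.mul hh.norm).intervalIntegrable _ _)
    (.of_forall fun x _ => hseries x)
  rw [fourierX_eq]
  refine (hint.mul_left (normConst : ℂ)).congr_fun fun m => ?_
  rw [intervalIntegral.integral_const_mul, fourierX_eq h]
  ring

/-! ### The Fourier transform in time -/

theorem fourierT_eq (g : ℝ → ℂ) (τ : ℝ) :
    fourierT g τ = normConst * ∫ t : ℝ, Complex.exp (-(Complex.I * t * τ)) * g t := rfl

theorem fourierT_eq_fourier (g : ℝ → ℂ) (τ : ℝ) :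
    fourierT g τ = normConst * 𝓕 g (τ / (2 * Real.pi)) := by
  have hpi : (Real.pi : ℂ) ≠ 0 := by exact_mod_cast Real.pi_ne_zero
  rw [fourierT_eq, Real.fourier_real_eq_integral_exp_smul]
  congr 2
  ext t
  rw [smul_eq_mul]
  congr 2
  push_cast
  field_simp

theorem fourierT_const_mul (c : ℂ) (g : ℝ → ℂ) (τ : ℝ) :
    fourierT (fun t => c * g t) τ = c * fourierT g τ := by
  simp only [fourierT_eq, mul_left_comm _ c, integral_const_mul]

theorem hasSum_fourierT {ι : Type*} [Countable ι] {f : ι → ℝ → ℂ} {g : ℝ → ℂ} {a : ι → ℝ}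
    {B : ℝ → ℝ} (hf : ∀ i, AEStronglyMeasurable (f i)) (ha : Summable a) (hB : Integrable B)
    (hfB : ∀ i t, ‖f i t‖ ≤ a i * B t) (hfg : ∀ t, HasSum (fun i => f i t) (g t)) (τ : ℝ) :
    HasSum (fun i => fourierT (f i) τ) (fourierT g τ) := by
  refine HasSum.mul_left _ (hasSum_integral_of_dominated_convergence (fun i t => a i * B t)
    (fun i => ?_) (fun i => .of_forall fun t => ?_) (.of_forall fun t => ha.mul_right _) ?_
    (.of_forall fun t => (hfg t).mul_left _))
  · exact (Continuous.aestronglyMeasurable (by fun_prop)).mul (hf i)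
  · simpa [Complex.norm_exp] using hfB i t
  · simpa only [tsum_mul_right] using hB.const_mul _

section Schwartz

variable (φ ψ : 𝓢(ℝ, ℂ))

theorem fourier_mul_eq_integral (s : ℝ) :
    𝓕 (fun t => φ t * ψ t) s = ∫ y, 𝓕 (φ : ℝ → ℂ) y * 𝓕 (ψ : ℝ → ℂ) (s - y) := by
  have hinv (χ : 𝓢(ℝ, ℂ)) (t : ℝ) : 𝓕 (𝓕 χ) (-t) = χ t := by
    rw [SchwartzMap.fourier_coe, ← Real.fourierInv_eq_fourier_neg, ← SchwartzMap.fourierInv_coe,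
      FourierTransform.fourierInv_fourier_eq]
  have hconv := SchwartzMap.convolution_apply (ContinuousLinearMap.mul ℂ ℂ) (𝓕 φ) (𝓕 ψ) s
  rw [MeasureTheory.convolution_def] at hconv
  refine Eq.trans ?_ hconv
  change _ = 𝓕⁻ (SchwartzMap.pairing (ContinuousLinearMap.mul ℂ ℂ) (𝓕 (𝓕 φ)) (𝓕 (𝓕 ψ))) s
  rw [SchwartzMap.fourierInv_coe, Real.fourierInv_eq_fourier_comp_neg]
  simp only [SchwartzMap.pairing_apply_apply, ContinuousLinearMap.mul_apply', hinv]

theorem fourierT_mul_eq_integral (τ : ℝ) :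
    fourierT (fun t => φ t * ψ t) τ = normConst * ∫ σ, fourierT φ σ * fourierT ψ (τ - σ) := by
  have hscale (σ : ℝ) : fourierT φ σ * fourierT ψ (τ - σ) = ((normConst * normConst : ℝ) : ℂ) *
      (𝓕 (φ : ℝ → ℂ) (σ / (2 * Real.pi)) *
        𝓕 (ψ : ℝ → ℂ) (τ / (2 * Real.pi) - σ / (2 * Real.pi))) := by
    rw [fourierT_eq_fourier, fourierT_eq_fourier, sub_div]
    push_cast
    ring
  rw [fourierT_eq_fourier, fourier_mul_eq_integral]
  congr 1
  simp_rw [hscale]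
  rw [integral_const_mul, Measure.integral_comp_div
      (fun y => 𝓕 (φ : ℝ → ℂ) y * 𝓕 (ψ : ℝ → ℂ) (τ / (2 * Real.pi) - y)) (2 * Real.pi),
    normConst_mul_self, abs_of_pos (by positivity), Complex.real_smul, ← mul_assoc,
    ← Complex.ofReal_mul, inv_mul_cancel₀ (by positivity), Complex.ofReal_one, one_mul]

theorem enorm_fourierT_mul_le (τ : ℝ) :
    ‖fourierT (fun t => φ t * ψ t) τ‖ₑ ≤ ∫⁻ σ, ‖fourierT φ σ‖ₑ * ‖fourierT ψ (τ - σ)‖ₑ := by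
  rw [fourierT_mul_eq_integral]
  refine ((enorm_normConst_mul_le _).trans (enorm_integral_le_lintegral_enorm _)).trans_eq ?_
  simp_rw [enorm_mul]

theorem continuous_fourierT : Continuous (fourierT φ) := by
  have hcont : Continuous (𝓕 (φ : ℝ → ℂ)) := (𝓕 φ).continuous
  rw [funext (fourierT_eq_fourier φ)]
  fun_prop

theorem integral_norm_fourierT_sq : ∫ τ, ‖fourierT φ τ‖ ^ 2 = ∫ t, ‖φ t‖ ^ 2 := by
  simp only [fourierT_eq_fourier, norm_mul, mul_pow, norm_normConst]
  rw [integral_const_mul, Measure.integral_comp_div (fun y => ‖𝓕 (φ : ℝ → ℂ) y‖ ^ 2),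
    ← SchwartzMap.fourier_coe, SchwartzMap.integral_norm_sq_fourier, abs_of_pos (by positivity),
    sq, normConst_mul_self, smul_eq_mul, inv_mul_cancel_left₀ (by positivity)]

theorem integrable_norm_sq : Integrable fun t => ‖φ t‖ ^ 2 :=
  (memLp_two_iff_integrable_sq_norm φ.continuous.aestronglyMeasurable).1 (φ.memLp 2)

theorem integrable_norm_fourierT_sq : Integrable fun τ => ‖fourierT φ τ‖ ^ 2 := by
  simp only [fourierT_eq_fourier, norm_mul, mul_pow]
  exact ((integrable_norm_sq (𝓕 φ)).comp_div (by positivity)).const_mul _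

theorem lintegral_enorm_fourierT_sq : ∫⁻ τ, ‖fourierT φ τ‖ₑ ^ 2 = ∫⁻ t, ‖φ t‖ₑ ^ 2 := by
  have hofReal {g : ℝ → ℂ} (hg : Integrable fun t => ‖g t‖ ^ 2) :
      ∫⁻ t, ‖g t‖ₑ ^ 2 = ENNReal.ofReal (∫ t, ‖g t‖ ^ 2) := by
    rw [ofReal_integral_eq_lintegral_ofReal hg (.of_forall fun t => by positivity)]
    simp only [ENNReal.ofReal_pow (norm_nonneg _), ofReal_norm]
  rw [hofReal (integrable_norm_fourierT_sq φ), hofReal (integrable_norm_sq φ),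
    integral_norm_fourierT_sq]

end Schwartz

theorem enorm_fourierT_le (g : ℝ → ℂ) (τ : ℝ) :
    ‖fourierT g τ‖ₑ ≤ ENNReal.ofReal normConst * ∫⁻ t, ‖g t‖ₑ := by
  rw [fourierT_eq, enorm_mul, ← ofReal_norm (normConst : ℂ), norm_normConst]
  gcongr
  refine (enorm_integral_le_lintegral_enorm _).trans_eq ?_
  simp [← ofReal_norm, Complex.norm_exp]

theorem enorm_fourierT_sq_le {g : ℝ → ℂ} {T : ℝ} (hg : Measurable g)
    (hsupp : ∀ t, T < |t| → g t = 0) (τ : ℝ) :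
    ‖fourierT g τ‖ₑ ^ 2 ≤ ENNReal.ofReal (T / Real.pi) * ∫⁻ t, ‖g t‖ₑ ^ 2 := by
  have hind (t : ℝ) : ‖g t‖ₑ = (Set.Icc (-T) T).indicator (1 : ℝ → ℝ≥0∞) t * ‖g t‖ₑ := by
    by_cases ht : t ∈ Set.Icc (-T) T
    · simp [ht]
    · simp [hsupp t (not_le.mp (abs_le.not.mpr ht))]
  have hlength : ∫⁻ t, (Set.Icc (-T) T).indicator (1 : ℝ → ℝ≥0∞) t ^ 2 =
      ENNReal.ofReal (2 * T) := by
    have hsq (t : ℝ) : (Set.Icc (-T) T).indicator (1 : ℝ → ℝ≥0∞) t ^ 2 =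
        (Set.Icc (-T) T).indicator 1 t := by
      by_cases ht : t ∈ Set.Icc (-T) T <;> simp [ht]
    simp_rw [hsq]
    rw [lintegral_indicator_one measurableSet_Icc, Real.volume_Icc]
    ring_nf
  have hcauchy := lintegral_mul_sq_le (μ := volume)
    (measurable_one.indicator (measurableSet_Icc (a := -T) (b := T))) hg.enorm
  calc ‖fourierT g τ‖ₑ ^ 2 ≤ (ENNReal.ofReal normConst * ∫⁻ t, ‖g t‖ₑ) ^ 2 := by
        gcongr
        exact enorm_fourierT_le g τ
    _ ≤ ENNReal.ofReal normConst ^ 2 * (ENNReal.ofReal (2 * T) * ∫⁻ t, ‖g t‖ₑ ^ 2) := by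
        rw [mul_pow, lintegral_congr hind, ← hlength]
        gcongr
    _ = ENNReal.ofReal (T / Real.pi) * ∫⁻ t, ‖g t‖ₑ ^ 2 := by
        rw [← mul_assoc, ← ENNReal.ofReal_pow normConst_pos.le,
          ← ENNReal.ofReal_mul (by positivity), sq, normConst_mul_self]
        field_simp

/-! ### Time-localized periodic functions -/

section ParametricIntegral

variable {E : Type*} [NormedAddCommGroup E] [NormedSpace ℝ E] {F : ℝ × ℝ → E}

theorem hasDerivAt_intervalIntegral_param (hF : ContDiff ℝ 1 F) (a b t₀ : ℝ) :
    HasDerivAt (fun t => ∫ x in a..b, F (t, x)) (∫ x in a..b, fderiv ℝ F (t₀, x) (1, 0)) t₀ := by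
  have hF' : Continuous fun p => fderiv ℝ F p (1, 0) :=
    (hF.continuous_fderiv one_ne_zero).clm_apply continuous_const
  obtain ⟨C, hC⟩ := ((isCompact_closedBall t₀ 1).prod
    (isCompact_uIcc (a := a) (b := b))).exists_bound_of_continuousOn hF'.continuousOn
  refine (intervalIntegral.hasDerivAt_integral_of_dominated_loc_of_deriv_le
    (F' := fun t x => fderiv ℝ F (t, x) (1, 0)) (bound := fun _ => C)
    (Metric.closedBall_mem_nhds t₀ one_pos) (.of_forall fun t => ?_) ?_ ?_
    (.of_forall fun x hx t ht => hC (t, x) ⟨ht, Set.uIoc_subset_uIcc hx⟩)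
    intervalIntegrable_const (.of_forall fun x _ t _ => ?_)).2
  · exact (hF.continuous.comp (Continuous.prodMk_right t)).aestronglyMeasurable
  · exact (hF.continuous.comp (Continuous.prodMk_right t₀)).intervalIntegrable _ _
  · exact (hF'.comp (Continuous.prodMk_right t₀)).aestronglyMeasurable
  · exact (hF.differentiable one_ne_zero (t, x)).hasFDerivAt.comp_hasDerivAt t
      ((hasDerivAt_id t).prodMk (hasDerivAt_const t x))

theorem contDiff_intervalIntegral_param (hF : ContDiff ℝ ∞ F) (a b : ℝ) :
    ContDiff ℝ ∞ fun t => ∫ x in a..b, F (t, x) := by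
  rw [contDiff_infty]
  intro n
  induction n generalizing F with
  | zero =>
    exact contDiff_zero.mpr (continuous_iff_continuousAt.mpr fun t =>
      (hasDerivAt_intervalIntegral_param (hF.of_le (by norm_num)) a b t).continuousAt)
  | succ n ih =>
    have hderiv := hasDerivAt_intervalIntegral_param (hF.of_le (by norm_num)) a b
    push_cast
    rw [contDiff_succ_iff_deriv]
    refine ⟨fun t => (hderiv t).differentiableAt, by simp, ?_⟩
    rw [funext fun t => (hderiv t).deriv]
    exact ih ((hF.fderiv_right (by norm_num)).clm_apply contDiff_const)

end ParametricIntegral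

theorem hasDerivAt_partialX {u : ℝ × ℝ → ℂ} (hu : Differentiable ℝ u) (t x : ℝ) :
    HasDerivAt (fun y => u (t, y)) (partialX u (t, x)) x :=
  (hu.comp (g := u) (by fun_prop : Differentiable ℝ fun y : ℝ => (t, y)) x).hasDerivAt

theorem partialX_eq_fderiv {u : ℝ × ℝ → ℂ} (hu : Differentiable ℝ u) :
    partialX u = fun p => fderiv ℝ u p (0, 1) :=
  funext fun p => (hasDerivAt_partialX hu p.1 p.2).unique
    ((hu p).hasFDerivAt.comp_hasDerivAt p.2 ((hasDerivAt_const p.2 p.1).prodMk (hasDerivAt_id p.2)))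

/-- Smooth functions of `(t, x)` that are `2π`-periodic in `x` and vanish for `|t| > T`. This class,
unlike `IsSper` with a support condition, is visibly closed under products and `∂_x`. -/
structure IsTest (T : ℝ) (u : ℝ × ℝ → ℂ) : Prop where
  smooth : ContDiff ℝ ∞ u
  periodic : ∀ t x : ℝ, u (t, x + 2 * Real.pi) = u (t, x)
  eq_zero : ∀ t x : ℝ, T < |t| → u (t, x) = 0

/-- The modulus `|ℱu(τ, ξ)|`, on which alone all the norms depend. -/
noncomputable def fourierAbs (u : ℝ × ℝ → ℂ) (q : ℝ × ℤ) : ℝ≥0∞ := ‖fourierTX u q.1 q.2‖ₑ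

/-- The spatial Fourier coefficient of `u`, as a function of time. -/
noncomputable def coeff (u : ℝ × ℝ → ℂ) (ξ : ℤ) (t : ℝ) : ℂ := fourierX (fun x => u (t, x)) ξ

theorem IsSper.isTest {T : ℝ} {u : ℝ × ℝ → ℂ} (hu : IsSper u)
    (hsupp : tsupport u ⊆ {p : ℝ × ℝ | |p.1| ≤ T}) : IsTest T u where
  smooth := hu.smooth
  periodic := hu.periodic
  eq_zero t x ht := by
    by_contra hne
    exact absurd (hsupp (subset_tsupport _ hne)) (not_le.mpr ht)

theorem summable_inv_one_add_sq_int : Summable fun m : ℤ => (1 + (m : ℝ) ^ 2)⁻¹ := by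
  refine (Real.summable_one_div_int_pow.mpr one_lt_two).of_norm_bounded_eventually ?_
  filter_upwards [(Set.finite_singleton (0 : ℤ)).compl_mem_cofinite] with m hm
  have hm' : (m : ℝ) ≠ 0 := by exact_mod_cast hm
  rw [Real.norm_of_nonneg (by positivity), one_div]
  gcongr
  linarith

namespace IsTest

variable {T : ℝ} {u v w : ℝ × ℝ → ℂ}

theorem mul (hu : IsTest T u) (hv : IsTest T v) : IsTest T fun p => u p * v p where
  smooth := hu.smooth.mul hv.smooth
  periodic t x := by rw [hu.periodic, hv.periodic]
  eq_zero t x ht := by rw [hu.eq_zero t x ht, zero_mul]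

theorem differentiable (hu : IsTest T u) : Differentiable ℝ u := hu.smooth.differentiable (by simp)

theorem isTest_partialX (hu : IsTest T u) : IsTest T (partialX u) where
  smooth := by
    rw [partialX_eq_fderiv hu.differentiable]
    exact (hu.smooth.fderiv_right (by norm_num)).clm_apply contDiff_const
  periodic t x := by
    have hshift : (fun y => u (t, y)) = fun y => u (t, y + 2 * Real.pi) :=
      funext fun y => (hu.periodic t y).symm
    simp only [partialX]
    conv_rhs => rw [hshift]
    exact (deriv_comp_add_const (fun y => u (t, y)) (2 * Real.pi) x).symm
  eq_zero t x ht := by simp [partialX, funext fun y => hu.eq_zero t y ht]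

theorem continuous_slice (hu : IsTest T u) (t : ℝ) : Continuous fun x => u (t, x) :=
  hu.smooth.continuous.comp (Continuous.prodMk_right t)

theorem coeff_partialX (hu : IsTest T u) (ξ : ℤ) (t : ℝ) :
    coeff (partialX u) ξ t = Complex.I * ξ * coeff u ξ t := by
  refine fourierX_deriv (hasDerivAt_partialX hu.differentiable t)
    (hu.isTest_partialX.continuous_slice t) ?_ ξ
  simpa using hu.periodic t 0

theorem contDiff_coeff (hu : IsTest T u) (ξ : ℤ) : ContDiff ℝ ∞ (coeff u ξ) := by
  refine contDiff_const.mul (contDiff_intervalIntegral_param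
    (F := fun p => Complex.exp (-(Complex.I * p.2 * ξ)) * u p) (.mul (.cexp ?_) hu.smooth) _ _)
  exact ((contDiff_const.mul (Complex.ofRealCLM.contDiff.comp contDiff_snd)).mul contDiff_const).neg

theorem coeff_eq_zero (hu : IsTest T u) (ξ : ℤ) {t : ℝ} (ht : T < |t|) : coeff u ξ t = 0 := by
  simp [coeff, fourierX, hu.eq_zero t _ ht]

theorem hasCompactSupport_coeff (hu : IsTest T u) (ξ : ℤ) : HasCompactSupport (coeff u ξ) :=
  HasCompactSupport.intro (isCompact_Icc (a := -T) (b := T)) fun _ ht =>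
    hu.coeff_eq_zero ξ (not_le.mp (abs_le.not.mpr ht))

/-- The spatial Fourier coefficient of a test function, bundled as a Schwartz function of time. -/
noncomputable def schwartzCoeff (hu : IsTest T u) (ξ : ℤ) : 𝓢(ℝ, ℂ) :=
  (hu.hasCompactSupport_coeff ξ).toSchwartzMap (hu.contDiff_coeff ξ)

theorem exists_norm_coeff_le (hu : IsTest T u) : ∃ C : ℝ, ∀ ξ t, ‖coeff u ξ t‖ ≤ C := by
  obtain ⟨C, hC⟩ := ((isCompact_Icc (a := -T) (b := T)).prod
    (isCompact_Icc (a := (0 : ℝ)) (b := 2 * Real.pi))).exists_bound_of_continuousOn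
    hu.smooth.continuous.continuousOn
  refine ⟨|C| * (2 * Real.pi), fun ξ t => ?_⟩
  rcases lt_or_ge T |t| with ht | ht
  · rw [hu.coeff_eq_zero ξ ht, norm_zero]
    positivity
  · exact norm_fourierX_le
      (fun x hx => (hC (t, x) ⟨abs_le.mp ht, hx.1.le, hx.2⟩).trans (le_abs_self C)) ξ

theorem exists_norm_coeff_le_inv (hu : IsTest T u) :
    ∃ C : ℝ, ∀ ξ t, ‖coeff u ξ t‖ ≤ C * (1 + (ξ : ℝ) ^ 2)⁻¹ := by
  obtain ⟨C, hC⟩ := hu.exists_norm_coeff_le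
  obtain ⟨D, hD⟩ := hu.isTest_partialX.isTest_partialX.exists_norm_coeff_le
  refine ⟨C + D, fun ξ t => ?_⟩
  have hsq : (ξ : ℝ) ^ 2 * ‖coeff u ξ t‖ ≤ D := by
    refine le_of_eq_of_le ?_ (hD ξ t)
    rw [hu.isTest_partialX.coeff_partialX, hu.coeff_partialX]
    simp [← mul_assoc, ← sq]
  rw [← div_eq_mul_inv, le_div_iff₀ (by positivity)]
  linarith [hC ξ t]

theorem summable_coeff (hu : IsTest T u) (t : ℝ) : Summable fun ξ => coeff u ξ t := by
  obtain ⟨C, hC⟩ := hu.exists_norm_coeff_le_inv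
  exact .of_norm_bounded (summable_inv_one_add_sq_int.mul_left C) fun ξ => hC ξ t

theorem hasSum_coeff_mul (hu : IsTest T u) (hv : IsTest T v) (ξ : ℤ) (t : ℝ) :
    HasSum (fun m : ℤ => normConst * (coeff u m t * coeff v (ξ - m) t))
      (coeff (fun p => u p * v p) ξ t) :=
  hasSum_fourierX_mul (hu.continuous_slice t) (hu.periodic t) (hu.summable_coeff t)
    (hv.continuous_slice t) ξ

theorem hasSum_fourierTX_mul (hu : IsTest T u) (hv : IsTest T v) (τ : ℝ) (ξ : ℤ) :
    HasSum (fun m : ℤ => normConst * fourierT (fun t => coeff u m t * coeff v (ξ - m) t) τ)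
      (fourierTX (fun p => u p * v p) τ ξ) := by
  obtain ⟨C, hC⟩ := hu.exists_norm_coeff_le_inv
  obtain ⟨D, hD⟩ := hv.exists_norm_coeff_le
  simp only [← fourierT_const_mul]
  refine hasSum_fourierT (B := (Set.Icc (-T) T).indicator fun _ => D) (fun m => ?_)
    (summable_inv_one_add_sq_int.mul_left C) ?_ (fun m t => ?_) (hu.hasSum_coeff_mul hv ξ) τ
  · exact (continuous_const.mul ((hu.contDiff_coeff m).continuous.mul
      (hv.contDiff_coeff (ξ - m)).continuous)).aestronglyMeasurable
  · exact (integrable_indicator_iff measurableSet_Icc).mpr (integrableOn_const (by simp))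
  · refine (norm_normConst_mul_le _).trans ?_
    by_cases ht : t ∈ Set.Icc (-T) T
    · rw [norm_mul, Set.indicator_of_mem ht]
      exact mul_le_mul (hC m t) (hD _ t) (norm_nonneg _) ((norm_nonneg _).trans (hC m t))
    · rw [Set.indicator_of_notMem ht, hv.coeff_eq_zero _ (not_le.mp (abs_le.not.mpr ht))]
      simp

theorem measurable_fourierAbs (hu : IsTest T u) : Measurable (fourierAbs u) :=
  measurable_from_prod_countable_left fun ξ =>
    (continuous_fourierT (hu.schwartzCoeff ξ)).measurable.enorm

theorem fourierAbs_mul_le (hu : IsTest T u) (hv : IsTest T v) (p : ℝ × ℤ) :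
    fourierAbs (fun p => u p * v p) p ≤
      ∫⁻ q, fourierAbs u q * fourierAbs v (p - q) ∂freqMeasure := by
  have hu' := hu.measurable_fourierAbs
  have hv' := hv.measurable_fourierAbs
  rw [lintegral_freqMeasure (by fun_prop), fourierAbs,
    ← (hu.hasSum_fourierTX_mul hv p.1 p.2).tsum_eq]
  refine enorm_tsum_le_tsum_enorm.trans (ENNReal.tsum_le_tsum fun m => ?_)
  exact (enorm_normConst_mul_le _).trans
    (enorm_fourierT_mul_le (hu.schwartzCoeff m) (hv.schwartzCoeff (p.2 - m)) p.1)

theorem fourierAbs_partialX (hu : IsTest T u) (q : ℝ × ℤ) :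
    fourierAbs (partialX u) q = ENNReal.ofReal |(q.2 : ℝ)| * fourierAbs u q := by
  have hcoeff : fourierTX (partialX u) q.1 q.2 = Complex.I * q.2 * fourierTX u q.1 q.2 :=
    (congrArg (fourierT · q.1) (funext (hu.coeff_partialX q.2))).trans (fourierT_const_mul _ _ _)
  rw [fourierAbs, hcoeff, enorm_mul, ← ofReal_norm (Complex.I * (q.2 : ℂ)), fourierAbs]
  simp

theorem fourierAbs_mul_mul_partialX_le (hu : IsTest T u) (hv : IsTest T v) (hw : IsTest T w)
    (p : ℝ × ℤ) :
    fourierAbs (fun p => u p * v p * partialX w p) p ≤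
      trilin freqMeasure (fun p q₁ q₂ => ENNReal.ofReal |((p - q₁ - q₂).2 : ℝ)|)
        (fourierAbs u) (fourierAbs v) (fourierAbs w) p := by
  have hu' := hu.measurable_fourierAbs
  have hv' := hv.measurable_fourierAbs
  have hw' := hw.isTest_partialX.measurable_fourierAbs
  simp_rw [mul_assoc]
  calc fourierAbs (fun p => u p * (v p * partialX w p)) p
      ≤ ∫⁻ q₁, fourierAbs u q₁ * ∫⁻ q₂, fourierAbs v q₂ *
          fourierAbs (partialX w) (p - q₁ - q₂) ∂freqMeasure ∂freqMeasure := by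
        refine (hu.fourierAbs_mul_le (hv.mul hw.isTest_partialX) p).trans ?_
        gcongr with q₁
        exact hv.fourierAbs_mul_le hw.isTest_partialX (p - q₁)
    _ = ∫⁻ q : (ℝ × ℤ) × (ℝ × ℤ), fourierAbs u q.1 * (fourierAbs v q.2 *
          fourierAbs (partialX w) (p - q.1 - q.2)) ∂(freqMeasure.prod freqMeasure) := by
        rw [lintegral_prod (μ := freqMeasure) _ (by fun_prop)]
        exact lintegral_congr fun q₁ => (lintegral_const_mul _ (by fun_prop)).symm
    _ = _ := by
        refine lintegral_congr fun q => ?_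
        rw [hw.fourierAbs_partialX]
        ring

end IsTest

/-! ### The gain from time localization -/

theorem lintegral_mul_le_two_mul_of_tail {X : Type*} [MeasurableSpace X] {μ : Measure X} {S : Set X}
    (hS : MeasurableSet S) {G w w' : X → ℝ≥0∞} (hG : Measurable G) {m : ℝ≥0∞}
    (hin : ∀ x ∈ S, w x ≤ m) (hout : ∀ x ∈ Sᶜ, m ≤ w' x) (hw : ∀ x ∈ Sᶜ, w x ≤ w' x)
    (htail : ∫⁻ x in S, G x ∂μ ≤ ∫⁻ x in Sᶜ, G x ∂μ) :
    ∫⁻ x, w x * G x ∂μ ≤ 2 * ∫⁻ x, w' x * G x ∂μ := by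
  have hinner : ∫⁻ x in S, w x * G x ∂μ ≤ ∫⁻ x in Sᶜ, w' x * G x ∂μ :=
    calc ∫⁻ x in S, w x * G x ∂μ ≤ ∫⁻ x in S, m * G x ∂μ :=
          setLIntegral_mono' hS fun x hx => mul_le_mul_left (hin x hx) _
      _ ≤ m * ∫⁻ x in Sᶜ, G x ∂μ := by rw [lintegral_const_mul _ hG]; gcongr
      _ ≤ ∫⁻ x in Sᶜ, w' x * G x ∂μ := by
          rw [← lintegral_const_mul _ hG]
          exact setLIntegral_mono' hS.compl fun x hx => mul_le_mul_left (hout x hx) _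
  have houter : ∫⁻ x in Sᶜ, w x * G x ∂μ ≤ ∫⁻ x in Sᶜ, w' x * G x ∂μ :=
    setLIntegral_mono' hS.compl fun x hx => mul_le_mul_left (hw x hx) _
  calc ∫⁻ x, w x * G x ∂μ = ∫⁻ x in S, w x * G x ∂μ + ∫⁻ x in Sᶜ, w x * G x ∂μ :=
        (lintegral_add_compl _ hS).symm
    _ ≤ 2 * ∫⁻ x in Sᶜ, w' x * G x ∂μ := by rw [two_mul]; gcongr
    _ ≤ 2 * ∫⁻ x, w' x * G x ∂μ := by gcongr; exact Measure.restrict_le_self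

theorem decay_neg_le_decay_neg {p x y : ℝ} (hp : 0 ≤ p) (h : |x| ≤ |y|) :
    decay (-p) x ≤ decay (-p) y := by
  rw [decay, decay, neg_neg]
  exact ENNReal.ofReal_le_ofReal (Real.rpow_le_rpow (bracket_pos x).le (bracket_le_bracket h) hp)

theorem decay_inv_le {p r : ℝ} (hp : 0 ≤ p) (hr : 0 < r) :
    decay p r⁻¹ ≤ ENNReal.ofReal (r ^ p) := by
  refine ENNReal.ofReal_le_ofReal ?_
  calc bracket r⁻¹ ^ (-p) ≤ r⁻¹ ^ (-p) :=
        Real.rpow_le_rpow_of_nonpos (inv_pos.mpr hr) ((le_abs_self _).trans (abs_le_bracket _))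
          (neg_nonpos.mpr hp)
    _ = r ^ p := by rw [Real.inv_rpow hr.le, Real.rpow_neg hr.le, inv_inv]

theorem lintegral_decay_le_of_tail {G : ℝ → ℝ≥0∞} (hG : Measurable G) {c R θ : ℝ} (hR : 0 ≤ R)
    (hθ : 0 ≤ θ) (hθ1 : θ ≤ 1)
    (htail : ∫⁻ τ in Metric.closedBall c R, G τ ≤ ∫⁻ τ in (Metric.closedBall c R)ᶜ, G τ) :
    ∫⁻ τ, decay (-θ) (τ - c) * G τ ≤
      2 * (decay (1 - θ) R * ∫⁻ τ, decay (-1) (τ - c) * G τ) := by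
  have hsplit (y : ℝ) : decay (-θ) y = decay (1 - θ) y * decay (-1) y := by
    rw [decay_mul_decay]
    ring_nf
  have hfar {τ : ℝ} (hτ : τ ∈ (Metric.closedBall c R)ᶜ) : |R| ≤ |τ - c| := by
    rw [abs_of_nonneg hR]
    exact (not_le.mp (Metric.mem_closedBall.not.mp hτ)).le
  calc ∫⁻ τ, decay (-θ) (τ - c) * G τ
      ≤ 2 * ∫⁻ τ, decay (1 - θ) R * decay (-1) (τ - c) * G τ := by
        refine lintegral_mul_le_two_mul_of_tail (m := decay (-θ) R)
          Metric.isClosed_closedBall.measurableSet hG (fun τ hτ => ?_) (fun τ hτ => ?_)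
          (fun τ hτ => ?_) htail
        · exact decay_neg_le_decay_neg hθ (by rwa [abs_of_nonneg hR])
        · rw [hsplit]
          gcongr
          exact decay_neg_le_decay_neg zero_le_one (hfar hτ)
        · rw [hsplit]
          gcongr
          exact decay_le_of_abs_le (by linarith) (hfar hτ)
    _ = _ := by
        simp_rw [mul_assoc]
        rw [lintegral_const_mul _ (by fun_prop)]

section TimeLocalized

variable {φ : 𝓢(ℝ, ℂ)} {T : ℝ}

/-- Uncertainty principle: an interval of length `1 / T` is too short to carry more than half of the
energy of the Fourier transform of a function living on `[-T, T]`. -/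
theorem lintegral_fourierT_closedBall_le (hT : 0 < T) (hφ : ∀ t, T < |t| → φ t = 0) (c : ℝ) :
    ∫⁻ τ in Metric.closedBall c (2 * T)⁻¹, ‖fourierT φ τ‖ₑ ^ 2 ≤
      ∫⁻ τ in (Metric.closedBall c (2 * T)⁻¹)ᶜ, ‖fourierT φ τ‖ₑ ^ 2 := by
  set E := ∫⁻ t, ‖φ t‖ₑ ^ 2
  set B := Metric.closedBall c (2 * T)⁻¹ with hB
  have hfinite : E ≠ ⊤ := by
    simpa [HasFiniteIntegral, enorm_pow] using (integrable_norm_sq φ).2.ne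
  have hball : ∫⁻ τ in B, ‖fourierT φ τ‖ₑ ^ 2 ≤ ENNReal.ofReal (1 / Real.pi) * E :=
    calc ∫⁻ τ in B, ‖fourierT φ τ‖ₑ ^ 2 ≤ ∫⁻ _ in B, ENNReal.ofReal (T / Real.pi) * E :=
          lintegral_mono fun τ => enorm_fourierT_sq_le φ.continuous.measurable hφ τ
      _ = ENNReal.ofReal (1 / Real.pi) * E := by
          rw [setLIntegral_const, hB, Real.volume_closedBall, mul_right_comm,
            ← ENNReal.ofReal_mul (by positivity)]
          field_simp
  have hhalf : 2 * ∫⁻ τ in B, ‖fourierT φ τ‖ₑ ^ 2 ≤ E :=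
    calc 2 * ∫⁻ τ in B, ‖fourierT φ τ‖ₑ ^ 2 ≤ ENNReal.ofReal (2 / Real.pi) * E := by
          rw [← mul_one_div, ENNReal.ofReal_mul two_pos.le, ENNReal.ofReal_ofNat, mul_assoc]
          gcongr
      _ ≤ 1 * E := by
          gcongr
          exact ENNReal.ofReal_le_one.mpr ((div_le_one Real.pi_pos).mpr Real.two_le_pi)
      _ = E := one_mul E
  have hball_finite : ∫⁻ τ in B, ‖fourierT φ τ‖ₑ ^ 2 ≠ ⊤ :=
    ne_top_of_le_ne_top (ENNReal.mul_ne_top ENNReal.ofReal_ne_top hfinite) hball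
  refine (ENNReal.add_le_add_iff_left hball_finite).mp ?_
  rwa [lintegral_add_compl _ Metric.isClosed_closedBall.measurableSet, ← two_mul,
    lintegral_enorm_fourierT_sq]

theorem lintegral_decay_fourierT_le (hT : 0 < T) (hφ : ∀ t, T < |t| → φ t = 0) (c : ℝ) {θ : ℝ}
    (hθ : 0 ≤ θ) (hθ1 : θ ≤ 1) :
    ∫⁻ τ, decay (-θ) (τ - c) * ‖fourierT φ τ‖ₑ ^ 2 ≤
      2 * ENNReal.ofReal ((2 * T) ^ (1 - θ)) *
        ∫⁻ τ, decay (-1) (τ - c) * ‖fourierT φ τ‖ₑ ^ 2 := by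
  have hmeas := (continuous_fourierT φ).measurable.enorm.pow_const 2
  refine (lintegral_decay_le_of_tail hmeas (by positivity) hθ hθ1
    (lintegral_fourierT_closedBall_le hT hφ c)).trans ?_
  rw [mul_assoc]
  gcongr
  exact decay_inv_le (by linarith) (by positivity)

end TimeLocalized

/-! ### The norms as weighted integrals -/

theorem ofReal_weight_sq (x y : ℝ) (z : ℂ) :
    ENNReal.ofReal (bracket x ^ (2 * (1 / 2) : ℝ) * bracket y ^ (2 * (1 / 2) : ℝ) * ‖z‖ ^ 2) =
      (decay (-(1 / 2)) x * decay (-(1 / 2)) y * ‖z‖ₑ) ^ 2 := by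
  have hx := (bracket_pos x).le
  have hy := (bracket_pos y).le
  rw [mul_pow, mul_pow, decay_sq, decay_sq, decay, decay, ENNReal.ofReal_mul (by positivity),
    ENNReal.ofReal_mul (by positivity), ENNReal.ofReal_pow (norm_nonneg z), ofReal_norm]
  norm_num

theorem normY_eq (f : ℝ × ℝ → ℂ) :
    normY (1 / 2) (-1) f =
      mixedNormSq (fun p => decay 1 (modP p) * decay (-(1 / 2)) p.2 * fourierAbs f p) ^
        (1 / 2 : ℝ) := by
  have hweight (τ : ℝ) (ξ : ℤ) : ENNReal.ofReal
      (bracket (τ + (ξ : ℝ) ^ 2) ^ (-1 : ℝ) * bracket ξ ^ (1 / 2 : ℝ) * ‖fourierTX f τ ξ‖) =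
      decay 1 (modP (τ, ξ)) * decay (-(1 / 2)) ξ * fourierAbs f (τ, ξ) := by
    have h₁ := (bracket_pos (τ + (ξ : ℝ) ^ 2)).le
    have h₂ := (bracket_pos ξ).le
    rw [ENNReal.ofReal_mul (by positivity), ENNReal.ofReal_mul (by positivity), ofReal_norm, decay,
      decay, neg_neg, modP, fourierAbs]
  simp only [normY, mixedNormSq, hweight]

namespace IsTest

variable {T : ℝ} {u v w : ℝ × ℝ → ℂ}

theorem normX_eq (hu : IsTest T u) :
    normX (1 / 2) (1 / 2) u =
      (∫⁻ q, (wP (1 / 2) q * fourierAbs u q) ^ 2 ∂freqMeasure) ^ (1 / 2 : ℝ) := by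
  have hmeas := hu.measurable_fourierAbs
  rw [lintegral_freqMeasure (by fun_prop)]
  simp only [normX, ofReal_weight_sq]
  rfl

theorem normXminus_eq (hu : IsTest T u) :
    normXminus (1 / 2) (1 / 2) u =
      (∫⁻ q, (wM (1 / 2) q * fourierAbs u q) ^ 2 ∂freqMeasure) ^ (1 / 2 : ℝ) := by
  have hmeas := hu.measurable_fourierAbs
  rw [lintegral_freqMeasure (by fun_prop)]
  simp only [normXminus, ofReal_weight_sq]
  rfl

theorem normProd_rpow_half (hu : IsTest T u) (hv : IsTest T v) (hw : IsTest T w) :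
    normProd (1 / 2) (1 / 2) (1 / 2) (fourierAbs u) (fourierAbs v) (fourierAbs w) ^ (1 / 2 : ℝ) =
      normX (1 / 2) (1 / 2) u * normX (1 / 2) (1 / 2) v * normXminus (1 / 2) (1 / 2) w := by
  have hhalf : (0 : ℝ) ≤ 1 / 2 := by norm_num
  rw [normProd, ENNReal.mul_rpow_of_nonneg _ _ hhalf, ENNReal.mul_rpow_of_nonneg _ _ hhalf,
    hu.normX_eq, hv.normX_eq, hw.normXminus_eq]

theorem tsum_lintegral_weight_le (hu : IsTest T u) (hT : 0 < T) (c : ℤ → ℝ) {b : ℝ} (hb : 0 ≤ b)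
    (hb1 : b ≤ 1 / 2) :
    ∑' ξ : ℤ, ∫⁻ τ : ℝ, (decay (-(1 / 2)) ξ * decay (-b) (τ - c ξ) * fourierAbs u (τ, ξ)) ^ 2 ≤
      2 * ENNReal.ofReal ((2 * T) ^ (1 - 2 * b)) * ∑' ξ : ℤ, ∫⁻ τ : ℝ,
        (decay (-(1 / 2)) ξ * decay (-(1 / 2)) (τ - c ξ) * fourierAbs u (τ, ξ)) ^ 2 := by
  rw [← ENNReal.tsum_mul_left]
  refine ENNReal.tsum_le_tsum fun ξ => ?_
  have hmeas : Measurable fun τ : ℝ => fourierAbs u (τ, ξ) :=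
    hu.measurable_fourierAbs.comp measurable_prodMk_right
  have hexpand (b : ℝ) :
      ∫⁻ τ : ℝ, (decay (-(1 / 2)) ξ * decay (-b) (τ - c ξ) * fourierAbs u (τ, ξ)) ^ 2 =
        decay (-(1 / 2)) ξ ^ 2 * ∫⁻ τ, decay (-(2 * b)) (τ - c ξ) * fourierAbs u (τ, ξ) ^ 2 := by
    rw [← lintegral_const_mul _ (by fun_prop)]
    simp_rw [mul_pow, decay_sq, mul_neg, mul_assoc]
  rw [hexpand, hexpand, mul_left_comm, mul_one_div_cancel two_ne_zero]
  gcongr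
  exact lintegral_decay_fourierT_le (φ := hu.schwartzCoeff ξ) hT (fun t ht => hu.coeff_eq_zero ξ ht)
    (c ξ) (by linarith) (by linarith)

theorem lintegral_wP_le (hu : IsTest T u) (hT : 0 < T) {b : ℝ} (hb : 0 ≤ b) (hb1 : b ≤ 1 / 2) :
    ∫⁻ q, (wP b q * fourierAbs u q) ^ 2 ∂freqMeasure ≤
      2 * ENNReal.ofReal ((2 * T) ^ (1 - 2 * b)) *
        ∫⁻ q, (wP (1 / 2) q * fourierAbs u q) ^ 2 ∂freqMeasure := by
  have hmeas := hu.measurable_fourierAbs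
  rw [lintegral_freqMeasure (by fun_prop), lintegral_freqMeasure (by fun_prop)]
  simpa only [wP, modP, sub_neg_eq_add] using
    hu.tsum_lintegral_weight_le hT (fun ξ => -(ξ : ℝ) ^ 2) hb hb1

theorem lintegral_wM_le (hu : IsTest T u) (hT : 0 < T) {b : ℝ} (hb : 0 ≤ b) (hb1 : b ≤ 1 / 2) :
    ∫⁻ q, (wM b q * fourierAbs u q) ^ 2 ∂freqMeasure ≤
      2 * ENNReal.ofReal ((2 * T) ^ (1 - 2 * b)) *
        ∫⁻ q, (wM (1 / 2) q * fourierAbs u q) ^ 2 ∂freqMeasure := by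
  have hmeas := hu.measurable_fourierAbs
  rw [lintegral_freqMeasure (by fun_prop), lintegral_freqMeasure (by fun_prop)]
  exact hu.tsum_lintegral_weight_le hT (fun ξ => (ξ : ℝ) ^ 2) hb hb1

theorem energy_le (hu : IsTest T u) (hv : IsTest T v) (hw : IsTest T w) (hT : 0 < T) :
    energy (fourierAbs u) (fourierAbs v) (fourierAbs w) ≤
      3 * (2 * ENNReal.ofReal ((2 * T) ^ (1 / 32 : ℝ))) ^ 2 *
        normProd (1 / 2) (1 / 2) (1 / 2) (fourierAbs u) (fourierAbs v) (fourierAbs w) := by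
  have hexp : (1 : ℝ) - 2 * (31 / 64) = 1 / 32 := by norm_num
  have hb : (0 : ℝ) ≤ 31 / 64 := by norm_num
  have hb1 : (31 / 64 : ℝ) ≤ 1 / 2 := by norm_num
  have h₁ := hu.lintegral_wP_le hT hb hb1
  have h₂ := hv.lintegral_wP_le hT hb hb1
  have h₃ := hw.lintegral_wM_le hT hb hb1
  rw [hexp] at h₁ h₂ h₃
  simp only [energy, normProd]
  set K := 2 * ENNReal.ofReal ((2 * T) ^ (1 / 32 : ℝ))
  set E₁ := ∫⁻ q, (wP (1 / 2) q * fourierAbs u q) ^ 2 ∂freqMeasure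
  set E₂ := ∫⁻ q, (wP (1 / 2) q * fourierAbs v q) ^ 2 ∂freqMeasure
  set E₃ := ∫⁻ q, (wM (1 / 2) q * fourierAbs w q) ^ 2 ∂freqMeasure
  calc _ ≤ E₁ * (K * E₂) * (K * E₃) + K * E₁ * E₂ * (K * E₃) + K * E₁ * (K * E₂) * E₃ := by gcongr
    _ = 3 * K ^ 2 * (E₁ * E₂ * E₃) := by ring

theorem normY_mul_mul_partialX_le (hu : IsTest T u) (hv : IsTest T v) (hw : IsTest T w) :
    normY (1 / 2) (-1) (fun p => u p * v p * partialX w p) ≤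
      mixedNormSq (trilin freqMeasure multiplier (fourierAbs u) (fourierAbs v) (fourierAbs w)) ^
        (1 / 2 : ℝ) := by
  rw [normY_eq]
  refine ENNReal.rpow_le_rpow (mixedNormSq_mono fun p => ?_) (by norm_num)
  have hfinite : decay 1 (modP p) * decay (-(1 / 2)) p.2 ≠ ⊤ :=
    ENNReal.mul_ne_top ENNReal.ofReal_ne_top ENNReal.ofReal_ne_top
  calc decay 1 (modP p) * decay (-(1 / 2)) p.2 * fourierAbs (fun p => u p * v p * partialX w p) p
      ≤ decay 1 (modP p) * decay (-(1 / 2)) p.2 * trilin freqMeasure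
          (fun p q₁ q₂ => ENNReal.ofReal |((p - q₁ - q₂).2 : ℝ)|)
          (fourierAbs u) (fourierAbs v) (fourierAbs w) p := by
        gcongr
        exact hu.fourierAbs_mul_mul_partialX_le hv hw p
    _ = _ := by
        rw [trilin, trilin, ← lintegral_const_mul' _ _ hfinite]
        simp only [multiplier, mul_assoc]

end IsTest

theorem rpow_half_le_of_le_sq_mul {a A b : ℝ≥0∞} (h : a ≤ A ^ 2 * b) :
    a ^ (1 / 2 : ℝ) ≤ A * b ^ (1 / 2 : ℝ) := by
  refine (ENNReal.rpow_le_rpow h (by norm_num)).trans_eq ?_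
  rw [ENNReal.mul_rpow_of_nonneg _ _ (by norm_num), ← ENNReal.rpow_natCast, ← ENNReal.rpow_mul]
  norm_num

theorem gain_constant_le (C : ℝ≥0) {T : ℝ} (hT : 0 < T) :
    C * (3 * (2 * ENNReal.ofReal ((2 * T) ^ (1 / 32 : ℝ))) ^ 2) ≤
      ENNReal.ofReal (√(3 * (C + 1)) * (2 * 2 ^ (1 / 32 : ℝ)) * T ^ (1 / 32 : ℝ)) ^ 2 := by
  have hreal : (C : ℝ) * (3 * (2 * (2 * T) ^ (1 / 32 : ℝ)) ^ 2) ≤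
      (√(3 * (C + 1)) * (2 * 2 ^ (1 / 32 : ℝ)) * T ^ (1 / 32 : ℝ)) ^ 2 := by
    rw [mul_assoc √_, mul_pow √_, Real.sq_sqrt (by positivity), Real.mul_rpow two_pos.le hT.le,
      mul_assoc 2]
    linarith [sq_nonneg (2 * ((2 : ℝ) ^ (1 / 32 : ℝ) * T ^ (1 / 32 : ℝ)))]
  rw [← ENNReal.ofReal_pow (by positivity)]
  refine le_of_eq_of_le ?_ (ENNReal.ofReal_le_ofReal hreal)
  rw [ENNReal.ofReal_mul (by positivity), ENNReal.ofReal_mul three_pos.le,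
    ENNReal.ofReal_pow (by positivity), ENNReal.ofReal_mul two_pos.le, ENNReal.ofReal_coe_nnreal,
    ENNReal.ofReal_ofNat, ENNReal.ofReal_ofNat]

end PeriodicBourgain

open PeriodicBourgain

theorem theorem3_general :
    ∃ c ε : ℝ, 0 < c ∧ 0 < ε ∧
      ∀ T : ℝ, 0 < T →
      ∀ u₁ u₂ u₃ : ℝ × ℝ → ℂ, IsTest T u₁ → IsTest T u₂ → IsTest T u₃ →
        normY (1 / 2) (-1) (fun p => u₁ p * u₂ p * partialX u₃ p) ≤
          ENNReal.ofReal (c * T ^ ε) * normX (1 / 2) (1 / 2) u₁ * normX (1 / 2) (1 / 2) u₂ *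
            normXminus (1 / 2) (1 / 2) u₃ := by
  obtain ⟨C, hC⟩ := exists_trilinear_estimate
  refine ⟨√(3 * (C + 1)) * (2 * 2 ^ (1 / 32 : ℝ)), 1 / 32, by positivity, by norm_num,
    fun T hT u₁ u₂ u₃ h₁ h₂ h₃ => ?_⟩
  have hsq := calc
    mixedNormSq (trilin freqMeasure multiplier (fourierAbs u₁) (fourierAbs u₂) (fourierAbs u₃))
    _ ≤ C * energy (fourierAbs u₁) (fourierAbs u₂) (fourierAbs u₃) :=
        hC _ _ _ h₁.measurable_fourierAbs h₂.measurable_fourierAbs h₃.measurable_fourierAbs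
    _ ≤ C * (3 * (2 * ENNReal.ofReal ((2 * T) ^ (1 / 32 : ℝ))) ^ 2 *
          normProd (1 / 2) (1 / 2) (1 / 2) (fourierAbs u₁) (fourierAbs u₂) (fourierAbs u₃)) := by
        gcongr
        exact h₁.energy_le h₂ h₃ hT
    _ ≤ ENNReal.ofReal (√(3 * (C + 1)) * (2 * 2 ^ (1 / 32 : ℝ)) * T ^ (1 / 32 : ℝ)) ^ 2 *
          normProd (1 / 2) (1 / 2) (1 / 2) (fourierAbs u₁) (fourierAbs u₂) (fourierAbs u₃) := by
        rw [← mul_assoc]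
        gcongr
        exact gain_constant_le C hT
  refine ((h₁.normY_mul_mul_partialX_le h₂ h₃).trans (rpow_half_le_of_le_sq_mul hsq)).trans_eq ?_
  rw [h₁.normProd_rpow_half h₂ h₃, ← mul_assoc, ← mul_assoc]

theorem theorem3 :
    ∃ c ε : ℝ, 0 < c ∧ 0 < ε ∧
      ∀ T : ℝ, 0 < T → T ≤ 1 →
      ∀ u₁ u₂ u₃ : ℝ × ℝ → ℂ,
        PeriodicBourgain.IsSper u₁ → PeriodicBourgain.IsSper u₂ → PeriodicBourgain.IsSper u₃ →
        tsupport u₁ ⊆ {p : ℝ × ℝ | |p.1| ≤ T} →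
        tsupport u₂ ⊆ {p : ℝ × ℝ | |p.1| ≤ T} →
        tsupport u₃ ⊆ {p : ℝ × ℝ | |p.1| ≤ T} →
        PeriodicBourgain.normY (1 / 2) (-1)
            (fun p => u₁ p * u₂ p * PeriodicBourgain.partialX u₃ p) ≤
          ENNReal.ofReal (c * T ^ ε) *
            PeriodicBourgain.normX (1 / 2) (1 / 2) u₁ *
            PeriodicBourgain.normX (1 / 2) (1 / 2) u₂ *
            PeriodicBourgain.normXminus (1 / 2) (1 / 2) u₃ := by
  obtain ⟨c, ε, hc, hε, h⟩ := theorem3_general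
  exact ⟨c, ε, hc, hε, fun T hT _ _ _ _ s₁ s₂ s₃ t₁ t₂ t₃ =>
    h T hT _ _ _ (s₁.isTest t₁) (s₂.isTest t₂) (s₃.isTest t₃)⟩
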